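/- **Theorem.** For $x=(x_0:x_1)$ and $y=(y_0:y_1)$ in $\mathbb P^1(\mathbb C)=\mathbb C\cup\{\infty\}$ (where $z\in\mathbb C$ is $(z:1)$ and $\infty=(1:0)$) put $$\delta(x,y)=\frac{|x_0y_1-y_0x_1|}{\max\{|x_0|,|x_1|\}\,\max\{|y_0|,|y_1|\}}.$$ For a Borel probability measure $\nu$ on $\mathbb P^1(\mathbb C)$ let $$I(\nu)=\iint-\log\delta(x,y)\,d\nu(x)\,d\nu(y)\in(-\infty,+\infty],$$ with $-\log 0=+\infty$ (the diagonal is not excluded), and for a closed set $E\subset\mathbb P^1(\mathbb C)$ let the $\delta$-Robin constant $V_\delta(E)$ be the infimum of $I(\nu)$ over all Borel probability measures $\nu$ supported on $E$. Let $\mu_{\mathbb R}$ be the measure $\frac{1}{\pi^2z}\log\left|\frac{z+1}{z-1}\right|dz$ on $\mathbb R$, and let $$c_1=\frac12\left\|\log\left(1+\frac1{(1-z)^2}\right)\right\|_{L^1(\mu_{\mathbb R})},\qquad c_2=\left\|\log\left(1+\frac1{(1-z)^2}\right)\right\|_{L^2(\mu_{\mathbb R})}.$$ Then $c_1=0.678\ldots$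 and $c_2=2.505\ldots$, that is, $0.678\le c_1<0.679$ and $2.505\le c_2<2.506$. For every $0<\epsilon<1$ the set $E_\epsilon=\{z\in\mathbb C:|\operatorname{Im}z|\le\epsilon\}\cup\{\infty\}$ satisfies $$V_\delta(E_\epsilon)\ \ge\ \frac{7\zeta(3)}{2\pi^2}-c_1\epsilon-c_2\epsilon^{1/8}.$$ In particular, every Borel probability measure $\mu$ supported on $E_\epsilon$ satisfies $$I(\mu)\ \ge\ \frac{7\zeta(3)}{2\pi^2}-c_1\epsilon-c_2\epsilon^{1/8}.$$ -/

import Mathlib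

open MeasureTheory
open scoped OnePoint

noncomputable section

namespace DeltaRobin

/-- The complex projective line `ℙ¹(ℂ) = ℂ ∪ {∞}`, with the topology of the Riemann sphere. -/
abbrev P1 : Type := OnePoint ℂ

instance : MeasurableSpace P1 := borel P1

instance : BorelSpace P1 := ⟨rfl⟩

/-- Homogeneous coordinates: `z = (z : 1)` and `∞ = (1 : 0)`. -/
def homCoords : P1 → (Fin 2 → ℂ)
  | ∞ => ![1, 0]
  | (z : ℂ) => ![z, 1]

/-- `|v₀ w₁ - w₀ v₁| / (max(|v₀|, |v₁|) max(|w₀|, |w₁|))`. -/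
def deltaHom (v w : Fin 2 → ℂ) : ℝ :=
  ‖v 0 * w 1 - w 0 * v 1‖ / (max ‖v 0‖ ‖v 1‖ * max ‖w 0‖ ‖w 1‖)

/-- The kernel `δ` on `ℙ¹(ℂ)`. -/
def delta (x y : P1) : ℝ := deltaHom (homCoords x) (homCoords y)

lemma deltaHom_smul (a b : ℂ) (ha : a ≠ 0) (hb : b ≠ 0) (v w : Fin 2 → ℂ) :
    deltaHom (a • v) (b • w) = deltaHom v w := by
  have ha' : 0 < ‖a‖ := norm_pos_iff.mpr ha
  have hb' : 0 < ‖b‖ := norm_pos_iff.mpr hb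
  have h : a * v 0 * (b * w 1) - b * w 0 * (a * v 1)
      = a * b * (v 0 * w 1 - w 0 * v 1) := by ring
  simp only [deltaHom, Pi.smul_apply, smul_eq_mul]
  rw [h]
  simp only [norm_mul]
  rw [← mul_max_of_nonneg _ _ ha'.le, ← mul_max_of_nonneg _ _ hb'.le,
    mul_mul_mul_comm, mul_div_mul_left _ _ (mul_pos ha' hb').ne']

lemma mk_homCoords (x : P1) : ∃ h : homCoords x ≠ 0,
    Projectivization.mk ℂ (homCoords x) h = OnePoint.equivProjectivization ℂ x := by
  induction x using OnePoint.rec with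
  | infty => exact ⟨by simp [homCoords], by simp [homCoords]⟩
  | coe z => exact ⟨by simp [homCoords], by simp [homCoords]⟩

/-- `δ` may be computed with any homogeneous coordinates of the two points. -/
lemma delta_eq_deltaHom (v w : Fin 2 → ℂ) (hv : v ≠ 0) (hw : w ≠ 0) (x y : P1)
    (hx : OnePoint.equivProjectivization ℂ x = Projectivization.mk ℂ v hv)
    (hy : OnePoint.equivProjectivization ℂ y = Projectivization.mk ℂ w hw) :
    delta x y = deltaHom v w := by
  obtain ⟨hx0, hx1⟩ := mk_homCoords x
  obtain ⟨hy0, hy1⟩ := mk_homCoords y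
  obtain ⟨a, ha⟩ := (Projectivization.mk_eq_mk_iff' ℂ _ _ hx0 hv).mp (hx1.trans hx)
  obtain ⟨b, hb⟩ := (Projectivization.mk_eq_mk_iff' ℂ _ _ hy0 hw).mp (hy1.trans hy)
  rw [delta, ← ha, ← hb]
  refine deltaHom_smul a b ?_ ?_ v w
  · rintro rfl
    exact hx0 (by rw [← ha, zero_smul])
  · rintro rfl
    exact hy0 (by rw [← hb, zero_smul])

/-- The kernel `-log δ(x, y)`, with value `+∞` on the diagonal. -/
def kernel (x y : P1) : EReal := -ENNReal.log (ENNReal.ofReal (delta x y))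

/-- The energy `I(ν) = ∬ -log δ(x, y) dν(x) dν(y)` as an extended real number: the integral of the
positive part minus the integral of the negative part. As `δ ≤ 2`, the latter is finite for a finite
measure. -/
def energy (ν : Measure P1) : EReal :=
  ((∫⁻ p, (kernel p.1 p.2).toENNReal ∂(ν.prod ν) : ENNReal) : EReal)
    - ((∫⁻ p, (-kernel p.1 p.2).toENNReal ∂(ν.prod ν) : ENNReal) : EReal)

/-- The `δ`-Robin constant of `E`: the infimum of the energies of the Borel probability measures
supported on `E`. -/
def robinConstant (E : Set P1) : EReal :=
  ⨅ (ν : Measure P1) (_ : IsProbabilityMeasure ν) (_ : ν Eᶜ = 0), energy ν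

/-- The closed strip `{z ∈ ℂ : |Im z| ≤ ε} ∪ {∞}`. -/
def strip (ε : ℝ) : Set P1 := ((↑) : ℂ → P1) '' {z : ℂ | |z.im| ≤ ε} ∪ {∞}

/-- The measure on `ℝ` with density `log |(z + 1) / (z - 1)| / (π² z)`. -/
def muR : Measure ℝ :=
  volume.withDensity fun z : ℝ =>
    ENNReal.ofReal (1 / (Real.pi ^ 2 * z) * Real.log |(z + 1) / (z - 1)|)

/-- `c₁ = ½ ‖log (1 + 1 / (1 - z)²)‖` in `L¹(μ_ℝ)`. -/
def c₁ : ℝ := 1 / 2 * lpNorm (fun z : ℝ => Real.log (1 + 1 / (1 - z) ^ 2)) 1 muR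

/-- `c₂ = ‖log (1 + 1 / (1 - z)²)‖` in `L²(μ_ℝ)`. -/
def c₂ : ℝ := lpNorm (fun z : ℝ => Real.log (1 + 1 / (1 - z) ^ 2)) 2 muR

end DeltaRobin

end

/-! The bound is classical potential theory on the sphere: the measure `muR` plays the part of the
equilibrium measure of the real line, and its potential is controlled slightly off that line. Write
V = 7ζ(3)/(2π²).

The density of `muR` is the average over 0 < θ < π of the Poisson kernels of the upper half plane at
e^{iθ}. The Poisson integral of log|x - t| at e^{iθ} is log max(|x - e^{-iθ}|, |x - e^{iθ}|)
(`poisson_log_norm_sub`), so the logarithmic potential of `muR` is the mean of these maxima. For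
real x both distances agree and Jensen's formula gives log⁺|x| (`potential_ofReal`). Hence the
δ-potential of `muR` is constant on the real line, equal to the mean of log⁺|t|, which a series
expansion of the density evaluates as V (`integral_posLog_muR`). If |Im x| ≤ ε, the potential
exceeds log⁺|x| by at most √ε (`potential_le`).

The chordal kernel is, up to constants, -log(1 - ⟨X, Y⟩) on the unit sphere. This is a series in
powers of ⟨X, Y⟩ with nonnegative coefficients, hence positive definite
(`diffForm_neg_log_one_sub_nonneg`). It differs from -log δ by `corr x + corr y`, which cancels when
tested on a difference of probability measures. With I(·,·) the mutual δ-energy, positivity at μ -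
`muR` gives I(μ) ≥ 2 I(μ, `muR`) - I(`muR`) ≥ 2(V - √ε) - V = V - 2√ε
(`le_integral_chord_add_corr`). A measure of finite energy charges neither ∞ nor the diagonal, so it
suffices to work in ℂ. This is stronger than the stated bound, because c₂ > 2, c₁ ≥ 0 and √ε ≤
ε^{1/8}.

The numerical values of c₁ and c₂ are a separate matter. The symmetries t ↦ -t, t ↦ 1/t of `muR` and
the substitution q = (1 - z)/(1 + z) reduce both norms to integrals over (0, 1) of powers of -log q,
divided by 1 - q², against logarithms of quadratics. The latter are replaced by rational polynomials
with certified error, after which everything is a rational combination of 1, π², π⁴ and ζ(3),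
divided by π². -/

noncomputable section

namespace DeltaRobin

open MeasureTheory Filter Topology

/-! ### Positivity of the logarithmic kernel on a sphere -/

section LogKernel

variable {α ι : Type*} [Fintype ι]

/-- The Gram kernel `∑ i, φ i x * φ i y` of a finite family of functions. -/
def gram (φ : ι → α → ℝ) (p : α × α) : ℝ := ∑ i, φ i p.1 * φ i p.2

lemma abs_gram_le_one {φ : ι → α → ℝ} (h1 : ∀ x, ∑ i, φ i x ^ 2 = 1) (p : α × α) :
    |gram φ p| ≤ 1 := by
  have h := Finset.sum_mul_sq_le_sq_mul_sq Finset.univ (fun i => φ i p.1) (fun i => φ i p.2)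
  rw [h1, h1] at h
  rw [← sq_le_one_iff_abs_le_one]
  simpa [gram] using h

lemma abs_le_one_of_sum_sq {φ : ι → α → ℝ} (h1 : ∀ x, ∑ i, φ i x ^ 2 = 1) (i : ι) (x : α) :
    |φ i x| ≤ 1 := by
  rw [← sq_le_one_iff_abs_le_one, ← h1 x]
  exact Finset.single_le_sum (f := fun j => φ j x ^ 2) (fun j _ => sq_nonneg _)
    (Finset.mem_univ i)

variable [MeasurableSpace α]

/-- The quadratic form of a symmetric kernel `F` at the signed measure `μ - ν`. -/
def diffForm (μ ν : Measure α) (F : α × α → ℝ) : ℝ :=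
  ∫ p, F p ∂(μ.prod μ) + ∫ p, F p ∂(ν.prod ν) - 2 * ∫ p, F p ∂(μ.prod ν)

lemma measurable_gram {φ : ι → α → ℝ} (hφ : ∀ i, Measurable (φ i)) : Measurable (gram φ) := by
  unfold gram
  exact Finset.measurable_sum _ fun i _ =>
    ((hφ i).comp measurable_fst).mul ((hφ i).comp measurable_snd)

/-- Expanding the k-th power over all maps f : `Fin k → ι` gives a sum of products G_f(x) G_f(y), so
the form at μ - ν is the sum of the squares (∫ G_f dμ - ∫ G_f dν)². -/
lemma diffForm_gram_pow_nonneg {φ : ι → α → ℝ} (hφ : ∀ i, Measurable (φ i))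
    (h1 : ∀ x, ∑ i, φ i x ^ 2 = 1) (μ ν : Measure α) [IsFiniteMeasure μ] [IsFiniteMeasure ν]
    (k : ℕ) : 0 ≤ diffForm μ ν fun p => gram φ p ^ k := by
  classical
  set G : (Fin k → ι) → α → ℝ := fun f x => ∏ j, φ (f j) x with hG
  have hGm : ∀ f, Measurable (G f) := fun f => Finset.measurable_prod _ fun j _ => hφ (f j)
  have hGb : ∀ f x, ‖G f x‖ ≤ 1 := fun f x => by
    rw [hG, norm_prod]
    exact Finset.prod_le_one (fun _ _ => norm_nonneg _)
      fun j _ => abs_le_one_of_sum_sq h1 (f j) x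
  have hGi : ∀ (m : Measure α) [IsFiniteMeasure m] f, Integrable (G f) m := fun m _ f =>
    Integrable.of_bound (hGm f).aestronglyMeasurable 1 (ae_of_all _ (hGb f))
  have hexp : ∀ p : α × α, gram φ p ^ k = ∑ f : Fin k → ι, G f p.1 * G f p.2 := fun p => by
    rw [gram, Fintype.sum_pow]
    simp only [hG, Finset.prod_mul_distrib]
  have hkey : ∀ (m n : Measure α) [IsFiniteMeasure m] [IsFiniteMeasure n],
      ∫ p, gram φ p ^ k ∂(m.prod n) = ∑ f, (∫ x, G f x ∂m) * ∫ x, G f x ∂n := fun m n _ _ => by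
    simp_rw [hexp]
    rw [integral_finsetSum _ fun f _ => (hGi m f).mul_prod (hGi n f)]
    exact Finset.sum_congr rfl fun f _ => integral_prod_mul _ _
  unfold diffForm
  rw [hkey, hkey, hkey, Finset.mul_sum, ← Finset.sum_add_distrib, ← Finset.sum_sub_distrib]
  refine Finset.sum_nonneg fun f _ => ?_
  nlinarith [sq_nonneg ((∫ x, G f x ∂μ) - ∫ x, G f x ∂ν)]

/-- Term-by-term integration of the Taylor series of -log(1 - r c). The factor r < 1 makes it
dominated by a geometric series even where c reaches 1; the limit r → 1 is taken separately. -/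
lemma hasSum_integral_neg_log_one_sub {β : Type*} [MeasurableSpace β] (m : Measure β)
    [IsFiniteMeasure m] {c : β → ℝ} (hc : Measurable c) (hc1 : ∀ p, |c p| ≤ 1) {r : ℝ}
    (hr0 : 0 ≤ r) (hr1 : r < 1) :
    HasSum (fun k : ℕ => r ^ (k + 1) / (k + 1) * ∫ p, c p ^ (k + 1) ∂m)
      (∫ p, -Real.log (1 - r * c p) ∂m) := by
  have hb : ∀ (k : ℕ) p, ‖(r * c p) ^ (k + 1) / ((k : ℝ) + 1)‖ ≤ r ^ (k + 1) := fun k p => by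
    rw [norm_div, norm_pow, norm_mul, Real.norm_of_nonneg hr0, mul_pow,
      Real.norm_of_nonneg (by positivity : (0 : ℝ) ≤ k + 1)]
    refine (div_le_self (by positivity) (by linarith [k.cast_nonneg (α := ℝ)])).trans ?_
    exact mul_le_of_le_one_right (by positivity) (pow_le_one₀ (norm_nonneg _) (hc1 p))
  have hm : ∀ k : ℕ, AEStronglyMeasurable (fun p => (r * c p) ^ (k + 1) / ((k : ℝ) + 1)) m :=
    fun k => (((hc.const_mul r).pow_const _).div_const _).aestronglyMeasurable
  have hi : ∀ k : ℕ, Integrable (fun p => (r * c p) ^ (k + 1) / ((k : ℝ) + 1)) m := fun k =>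
    Integrable.of_bound (hm k) _ (ae_of_all _ (hb k))
  have hs : Summable fun k : ℕ => ∫ p, ‖(r * c p) ^ (k + 1) / ((k : ℝ) + 1)‖ ∂m := by
    refine Summable.of_nonneg_of_le (fun k => integral_nonneg fun _ => norm_nonneg _)
      (fun k => ?_) (((summable_nat_add_iff 1).2
        (summable_geometric_of_lt_one hr0 hr1)).mul_left (m.real Set.univ))
    refine (integral_mono (hi k).norm (integrable_const (r ^ (k + 1))) (hb k)).trans ?_
    simp
  have h := hasSum_integral_of_summable_integral_norm hi hs
  have he : ∀ p, ∑' k : ℕ, (r * c p) ^ (k + 1) / ((k : ℝ) + 1) = -Real.log (1 - r * c p) :=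
    fun p => by
      refine (Real.hasSum_pow_div_log_of_abs_lt_one ?_).tsum_eq
      rw [abs_mul, abs_of_nonneg hr0]
      exact (mul_le_of_le_one_right hr0 (hc1 p)).trans_lt hr1
  simp_rw [he] at h
  refine h.congr_fun fun k => ?_
  rw [← integral_const_mul]
  refine integral_congr_ae (ae_of_all _ fun p => ?_)
  simp only [mul_pow]
  ring

lemma diffForm_neg_log_one_sub_mul_nonneg {φ : ι → α → ℝ} (hφ : ∀ i, Measurable (φ i))
    (h1 : ∀ x, ∑ i, φ i x ^ 2 = 1) (μ ν : Measure α) [IsFiniteMeasure μ] [IsFiniteMeasure ν]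
    {r : ℝ} (hr0 : 0 ≤ r) (hr1 : r < 1) :
    0 ≤ diffForm μ ν fun p => -Real.log (1 - r * gram φ p) := by
  have key : ∀ (m n : Measure α) [IsFiniteMeasure m] [IsFiniteMeasure n], _ := fun m n _ _ =>
    hasSum_integral_neg_log_one_sub (m.prod n) (measurable_gram hφ) (abs_gram_le_one h1) hr0 hr1
  have h := ((key μ μ).add (key ν ν)).sub ((key μ ν).mul_left 2)
  refine h.nonneg fun k => ?_
  have h0 := mul_nonneg (by positivity : 0 ≤ r ^ (k + 1) / ((k : ℝ) + 1))
    (diffForm_gram_pow_nonneg hφ h1 μ ν (k + 1))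
  unfold diffForm at h0
  linarith

/-- Supplies a majorant independent of r for the limit r → 1: since -1 ≤ c < 1, the number 1 - r c
lies between (1 - c)/2 and 2. -/
lemma abs_log_one_sub_mul_le {c r : ℝ} (hc : |c| ≤ 1) (hc1 : c ≠ 1) (hr0 : 0 ≤ r) (hr1 : r < 1) :
    |Real.log (1 - r * c)| ≤ |Real.log (1 - c)| + Real.log 2 := by
  have hl2 : 0 ≤ Real.log 2 := Real.log_nonneg (by norm_num)
  obtain ⟨h1, h2⟩ := abs_le.1 hc
  have h2 : c < 1 := lt_of_le_of_ne h2 hc1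
  have hpos : 0 < 1 - r * c := by nlinarith
  rw [abs_le]
  constructor
  · have : (1 - c) / 2 ≤ 1 - r * c := by
      rcases le_total 0 c with h | h <;> nlinarith
    have h3 := Real.log_le_log (by linarith) this
    rw [Real.log_div (by linarith) (by norm_num)] at h3
    linarith [neg_abs_le (Real.log (1 - c))]
  · have := Real.log_le_log hpos (by nlinarith : 1 - r * c ≤ 2)
    linarith [abs_nonneg (Real.log (1 - c))]

lemma tendsto_integral_log_one_sub_mul {β : Type*} [MeasurableSpace β] (m : Measure β)
    [IsFiniteMeasure m] {c : β → ℝ} (hc : Measurable c) (hc1 : ∀ p, |c p| ≤ 1)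
    (hne : ∀ᵐ p ∂m, c p ≠ 1) (hi : Integrable (fun p => Real.log (1 - c p)) m) :
    Tendsto (fun r : ℝ => ∫ p, -Real.log (1 - r * c p) ∂m) (𝓝[<] 1)
      (𝓝 (∫ p, -Real.log (1 - c p) ∂m)) := by
  have hr : ∀ᶠ r : ℝ in 𝓝[<] 1, 0 ≤ r ∧ r < 1 := by
    filter_upwards [Ioo_mem_nhdsLT (zero_lt_one (α := ℝ))] with r hr using ⟨hr.1.le, hr.2⟩
  refine tendsto_integral_filter_of_dominated_convergence
    (fun p => |Real.log (1 - c p)| + Real.log 2) ?_ ?_ (hi.abs.add (integrable_const _)) ?_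
  · exact Eventually.of_forall fun r =>
      (Real.measurable_log.comp ((hc.const_mul r).const_sub 1)).neg.aestronglyMeasurable
  · filter_upwards [hr] with r hr
    filter_upwards [hne] with p hp
    rw [norm_neg]
    exact abs_log_one_sub_mul_le (hc1 p) hp hr.1 hr.2
  · filter_upwards [hne] with p hp
    have h0 : 1 - 1 * c p ≠ 0 := by
      rw [one_mul]; exact sub_ne_zero.2 hp.symm
    have : ContinuousAt (fun r : ℝ => -Real.log (1 - r * c p)) 1 :=
      ((by fun_prop : ContinuousAt (fun r : ℝ => 1 - r * c p) 1).log h0).neg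
    simpa using this.tendsto.mono_left nhdsWithin_le_nhds

/-- The kernel `-log (1 - ⟨X, Y⟩)` on a sphere is positive definite. -/
theorem diffForm_neg_log_one_sub_nonneg {φ : ι → α → ℝ} (hφ : ∀ i, Measurable (φ i))
    (h1 : ∀ x, ∑ i, φ i x ^ 2 = 1) (μ ν : Measure α) [IsFiniteMeasure μ] [IsFiniteMeasure ν]
    (hμμ : ∀ᵐ p ∂(μ.prod μ), gram φ p ≠ 1) (hνν : ∀ᵐ p ∂(ν.prod ν), gram φ p ≠ 1)
    (hμν : ∀ᵐ p ∂(μ.prod ν), gram φ p ≠ 1)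
    (iμμ : Integrable (fun p => Real.log (1 - gram φ p)) (μ.prod μ))
    (iνν : Integrable (fun p => Real.log (1 - gram φ p)) (ν.prod ν))
    (iμν : Integrable (fun p => Real.log (1 - gram φ p)) (μ.prod ν)) :
    0 ≤ diffForm μ ν fun p => -Real.log (1 - gram φ p) := by
  have hm := measurable_gram hφ
  have hb := abs_gram_le_one h1
  have h := ((tendsto_integral_log_one_sub_mul _ hm hb hμμ iμμ).add
    (tendsto_integral_log_one_sub_mul _ hm hb hνν iνν)).sub
    ((tendsto_integral_log_one_sub_mul _ hm hb hμν iμν).const_mul 2)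
  refine ge_of_tendsto h ?_
  filter_upwards [Ioo_mem_nhdsLT (zero_lt_one (α := ℝ))] with r hr
  exact diffForm_neg_log_one_sub_mul_nonneg hφ h1 μ ν hr.1.le hr.2

end LogKernel

/-! ### Logarithmic Poisson integrals -/

/-- The point `e ^ (i θ)` of the unit circle. -/
def unitPt (θ : ℝ) : ℂ := Complex.exp (θ * Complex.I)

lemma norm_unitPt (θ : ℝ) : ‖unitPt θ‖ = 1 := Complex.norm_exp_ofReal_mul_I θ

lemma unitPt_re (θ : ℝ) : (unitPt θ).re = Real.cos θ := Complex.exp_ofReal_mul_I_re θ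

lemma unitPt_im (θ : ℝ) : (unitPt θ).im = Real.sin θ := Complex.exp_ofReal_mul_I_im θ

lemma unitPt_add (θ φ : ℝ) : unitPt (θ + φ) = unitPt θ * unitPt φ := by
  simp [unitPt, add_mul, Complex.exp_add]

lemma unitPt_two_pi : unitPt (2 * Real.pi) = 1 := by
  rw [unitPt]; push_cast; exact Complex.exp_two_pi_mul_I

lemma unitPt_neg (θ : ℝ) : unitPt (-θ) = starRingEnd ℂ (unitPt θ) := by
  rw [unitPt, unitPt, ← Complex.exp_conj]; simp

lemma continuous_unitPt : Continuous unitPt := by unfold unitPt; fun_prop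

lemma intervalIntegrable_log_norm_unitPt_sub (a : ℂ) (s t : ℝ) :
    IntervalIntegrable (fun θ => Real.log ‖unitPt θ - a‖) volume s t := by
  have h : CircleIntegrable (fun z => Real.log ‖z - a‖) 0 1 := circleIntegrable_log_norm_sub_const 1
  have h2 : IntervalIntegrable (fun θ => Real.log ‖unitPt θ - a‖) volume 0 (0 + 2 * Real.pi) := by
    simpa [CircleIntegrable, circleMap, unitPt] using h
  refine Function.Periodic.intervalIntegrable (fun θ => ?_) (by positivity) h2 s t
  simp [unitPt_add, unitPt_two_pi]

lemma integral_log_norm_unitPt_sub (a : ℂ) (s : ℝ) :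
    ∫ θ in s..s + 2 * Real.pi, Real.log ‖unitPt θ - a‖ = 2 * Real.pi * Real.posLog ‖a‖ := by
  have hper : Function.Periodic (fun θ => Real.log ‖unitPt θ - a‖) (2 * Real.pi) := fun θ => by
    simp [unitPt_add, unitPt_two_pi]
  have h := circleAverage_log_norm_sub_const_eq_posLog (a := a)
  rw [Real.circleAverage_def] at h
  rw [hper.intervalIntegral_add_eq s 0, zero_add, ← h, smul_eq_mul,
    mul_inv_cancel_left₀ (by positivity)]
  simp [circleMap, unitPt]

lemma intervalIntegrable_log_norm_unitPt_two_mul_sub (a : ℂ) (s t : ℝ) :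
    IntervalIntegrable (fun θ => Real.log ‖unitPt (2 * θ) - a‖) volume s t := by
  have h := (intervalIntegrable_log_norm_unitPt_sub a (2 * s) (2 * t)).comp_mul_left (c := 2)
  simpa using h

lemma integral_log_norm_unitPt_two_mul_sub (a : ℂ) (s : ℝ) :
    ∫ θ in s..s + Real.pi, Real.log ‖unitPt (2 * θ) - a‖ = Real.pi * Real.posLog ‖a‖ := by
  rw [intervalIntegral.integral_comp_mul_left (fun θ => Real.log ‖unitPt θ - a‖) two_ne_zero,
    mul_add, integral_log_norm_unitPt_sub, smul_eq_mul]
  ring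

lemma log_norm_div_add_posLog {p q : ℂ} (hp : p ≠ 0) :
    Real.log ‖p‖ + Real.posLog ‖q / p‖ = Real.log (max ‖p‖ ‖q‖) := by
  have hp' : 0 < ‖p‖ := norm_pos_iff.2 hp
  rw [Real.posLog_eq_log_max_one (norm_nonneg _), ← Real.log_mul hp'.ne' (by positivity),
    mul_max_of_nonneg _ _ hp'.le, norm_div, mul_one, mul_div_cancel₀ _ hp'.ne']

/-- The values `x - (a + b tan u)` in terms of `e ^ (2 i u)`. -/
lemma two_mul_sub_tan_eq (x : ℂ) (a b u : ℝ) (hu : Real.cos u ≠ 0) :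
    (x - (a + b * Real.tan u : ℝ)) * (unitPt (2 * u) + 1)
      = unitPt (2 * u) * (x - (a - b * Complex.I)) + (x - (a + b * Complex.I)) := by
  have hc : (Real.cos u : ℂ) ≠ 0 := by exact_mod_cast hu
  have h2 : unitPt (2 * u) = unitPt u * unitPt u := by rw [two_mul, unitPt_add]
  have he : unitPt u = Real.cos u + Real.sin u * Complex.I := by
    apply Complex.ext <;> simp [unitPt_re, unitPt_im, -Complex.ofReal_cos, -Complex.ofReal_sin]
  have hsc : (Real.sin u : ℂ) ^ 2 = 1 - (Real.cos u : ℂ) ^ 2 := by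
    have := Real.sin_sq u
    exact_mod_cast this
  have h3 : unitPt (2 * u) + 1 = 2 * Real.cos u * unitPt u := by
    rw [h2, he]; ring_nf; rw [Complex.I_sq, hsc]; ring
  have h4 : unitPt (2 * u) - 1 = 2 * Real.sin u * unitPt u * Complex.I := by
    rw [h2, he]; ring_nf; rw [Complex.I_sq, hsc]; ring
  rw [Real.tan_eq_sin_div_cos]
  push_cast
  have h5 : (x - (a + b * ((Real.sin u : ℂ) / Real.cos u))) * (unitPt (2 * u) + 1)
      = (x - a) * (unitPt (2 * u) + 1) - b * (2 * Real.sin u * unitPt u) := by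
    rw [h3]; field_simp; ring
  have h6 : 2 * Real.sin u * unitPt u = -Complex.I * (unitPt (2 * u) - 1) := by
    rw [h4]; ring_nf; rw [Complex.I_sq]; ring
  push_cast at h5 h6
  rw [h5, h6]
  ring

/-- The Poisson kernel `b / ((t - a)² + b²)` of the upper half plane, up to the factor `π`. -/
def poisson (a b t : ℝ) : ℝ := b / ((t - a) ^ 2 + b ^ 2)

lemma poisson_nonneg {b : ℝ} (hb : 0 ≤ b) (a t : ℝ) : 0 ≤ poisson a b t :=
  div_nonneg hb (by positivity)

lemma image_add_mul_tan (a : ℝ) {b : ℝ} (hb : 0 < b) :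
    (fun u => a + b * Real.tan u) '' Set.Ioo (-(Real.pi / 2)) (Real.pi / 2) = Set.univ := by
  rw [show (fun u => a + b * Real.tan u) = (fun y => a + b * y) ∘ Real.tan from rfl,
    Set.image_comp, Real.image_tan_Ioo, Set.image_univ]
  refine Set.range_eq_univ.2 fun y => ⟨(y - a) / b, ?_⟩
  field_simp
  ring

lemma injOn_add_mul_tan (a : ℝ) {b : ℝ} (hb : 0 < b) :
    Set.InjOn (fun u => a + b * Real.tan u) (Set.Ioo (-(Real.pi / 2)) (Real.pi / 2)) :=
  fun u hu v hv h => Real.injOn_tan hu hv (by simpa [hb.ne'] using h)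

lemma hasDerivWithinAt_add_mul_tan (a b : ℝ) :
    ∀ u ∈ Set.Ioo (-(Real.pi / 2)) (Real.pi / 2),
      HasDerivWithinAt (fun u => a + b * Real.tan u) (b * (1 / Real.cos u ^ 2))
        (Set.Ioo (-(Real.pi / 2)) (Real.pi / 2)) u := fun _ hu =>
  (((Real.hasDerivAt_tan_of_mem_Ioo hu).const_mul b).const_add a).hasDerivWithinAt

/-- The reason for the substitution t = a + b tan u: its Jacobian b / cos² u is exactly the
reciprocal of the Poisson kernel, so Poisson integrals become plain integrals over (-π/2, π/2). -/
lemma abs_deriv_smul_poisson (a : ℝ) {b u : ℝ} (hb : 0 < b) (hu : 0 < Real.cos u) (y : ℝ) :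
    |b * (1 / Real.cos u ^ 2)| • (y * poisson a b (a + b * Real.tan u)) = y := by
  have h1 : 0 ≤ b * (1 / Real.cos u ^ 2) := by positivity
  rw [abs_of_nonneg h1, smul_eq_mul, poisson, add_sub_cancel_left, Real.tan_eq_sin_div_cos]
  have h2 : (b * (Real.sin u / Real.cos u)) ^ 2 + b ^ 2 = b ^ 2 / Real.cos u ^ 2 := by
    field_simp
    exact Real.sin_sq_add_cos_sq u
  rw [h2]
  field_simp

lemma integrable_mul_poisson_iff (a : ℝ) {b : ℝ} (hb : 0 < b) (g : ℝ → ℝ) :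
    Integrable (fun t => g t * poisson a b t) ↔
      IntegrableOn (fun u => g (a + b * Real.tan u)) (Set.Ioo (-(Real.pi / 2)) (Real.pi / 2)) := by
  rw [← integrableOn_univ, ← image_add_mul_tan a hb,
    integrableOn_image_iff_integrableOn_abs_deriv_smul measurableSet_Ioo
      (hasDerivWithinAt_add_mul_tan a b) (injOn_add_mul_tan a hb)]
  exact integrableOn_congr_fun (fun u hu =>
    abs_deriv_smul_poisson a hb (Real.cos_pos_of_mem_Ioo hu) _) measurableSet_Ioo

lemma integral_mul_poisson (a : ℝ) {b : ℝ} (hb : 0 < b) (g : ℝ → ℝ) :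
    ∫ t, g t * poisson a b t
      = ∫ u in Set.Ioo (-(Real.pi / 2)) (Real.pi / 2), g (a + b * Real.tan u) := by
  rw [← setIntegral_univ, ← image_add_mul_tan a hb,
    integral_image_eq_integral_abs_deriv_smul measurableSet_Ioo
      (hasDerivWithinAt_add_mul_tan a b) (injOn_add_mul_tan a hb)]
  exact setIntegral_congr_fun measurableSet_Ioo fun u hu =>
    abs_deriv_smul_poisson a hb (Real.cos_pos_of_mem_Ioo hu) _

lemma integrable_poisson (a : ℝ) {b : ℝ} (hb : 0 < b) : Integrable (poisson a b) := by
  simpa using (integrable_mul_poisson_iff a hb fun _ => 1).2 (by simp)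

lemma integral_poisson (a : ℝ) {b : ℝ} (hb : 0 < b) : ∫ t, poisson a b t = Real.pi := by
  have h := integral_mul_poisson a hb fun _ => 1
  have h2 : Real.pi / 2 + Real.pi / 2 = Real.pi := by ring
  simpa [h2, Real.pi_pos.le] using h

/-- With p = x - (a - bi) and q = x - (a + bi), the identity (x - t)(e^{2iu} + 1) = e^{2iu} p + q
turns log|x - t| into a constant plus logarithmic distances from e^{2iu} to the fixed points v =
-q/p and -1. Jensen's formula then integrates each term. If p = 0 the numerator has constant modulus
|q|, and v = 0 serves. At most one u, where x = t, is excluded. -/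
lemma log_norm_sub_add_mul_tan_ae (x : ℂ) (a : ℝ) {b : ℝ} (hb : 0 < b) :
    ∃ (s : ℝ) (v : ℂ), s + Real.posLog ‖v‖
        = Real.log (max ‖x - (a - b * Complex.I)‖ ‖x - (a + b * Complex.I)‖) ∧
      (fun u : ℝ => Real.log ‖x - (a + b * Real.tan u : ℝ)‖)
        =ᵐ[volume.restrict (Set.Ioo (-(Real.pi / 2)) (Real.pi / 2))]
      fun u => s + Real.log ‖unitPt (2 * u) - v‖ - Real.log ‖unitPt (2 * u) - (-1)‖ := by
  set p : ℂ := x - (a - b * Complex.I) with hp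
  set q : ℂ := x - (a + b * Complex.I) with hq
  have hpq : q - p = -(2 * b * Complex.I) := by rw [hp, hq]; ring
  have hae : ∀ᵐ u ∂(volume.restrict (Set.Ioo (-(Real.pi / 2)) (Real.pi / 2))),
      u ∈ Set.Ioo (-(Real.pi / 2)) (Real.pi / 2) ∧ x - (a + b * Real.tan u : ℝ) ≠ 0 := by
    rw [ae_restrict_iff' measurableSet_Ioo, ae_iff]
    refine Set.Subsingleton.measure_zero ?_ _
    intro u hu v hv
    simp only [Set.mem_ofPred_eq, Classical.not_imp, not_and, not_not] at hu hv
    refine injOn_add_mul_tan a hb hu.1 hv.1 ?_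
    have h1 := hu.2 hu.1
    have h2 := hv.2 hv.1
    exact_mod_cast (sub_eq_zero.1 h1).symm.trans (sub_eq_zero.1 h2)
  have hne : ∀ u ∈ Set.Ioo (-(Real.pi / 2)) (Real.pi / 2), unitPt (2 * u) + 1 ≠ 0 := by
    intro u hu h
    have h3 := congrArg Complex.re h
    rw [Complex.add_re, unitPt_re, Real.cos_two_mul] at h3
    have h4 := Real.cos_pos_of_mem_Ioo hu
    simp at h3
    exact h4.ne' h3
  have hlog : ∀ u ∈ Set.Ioo (-(Real.pi / 2)) (Real.pi / 2), x - (a + b * Real.tan u : ℝ) ≠ 0 →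
      unitPt (2 * u) * p + q ≠ 0 ∧ Real.log ‖x - (a + b * Real.tan u : ℝ)‖
        = Real.log ‖unitPt (2 * u) * p + q‖ - Real.log ‖unitPt (2 * u) - (-1)‖ := by
    intro u hu hx
    have h := two_mul_sub_tan_eq x a b u (Real.cos_pos_of_mem_Ioo hu).ne'
    rw [← hp, ← hq] at h
    refine ⟨h ▸ mul_ne_zero hx (hne u hu), ?_⟩
    rw [← h, norm_mul, sub_neg_eq_add, Real.log_mul (norm_ne_zero_iff.2 hx)
      (norm_ne_zero_iff.2 (hne u hu)), add_sub_cancel_right]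
  by_cases hp0 : p = 0
  · refine ⟨Real.log ‖q‖, 0, by simp [hp0], ?_⟩
    filter_upwards [hae] with u hu
    rw [(hlog u hu.1 hu.2).2, hp0, mul_zero, zero_add, sub_zero, norm_unitPt, Real.log_one,
      add_zero]
  · refine ⟨Real.log ‖p‖, -(q / p), by rw [norm_neg, log_norm_div_add_posLog hp0], ?_⟩
    filter_upwards [hae] with u hu
    obtain ⟨h1, h2⟩ := hlog u hu.1 hu.2
    have h3 : unitPt (2 * u) * p + q = p * (unitPt (2 * u) - -(q / p)) := by field_simp; ring
    rw [h3] at h1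
    rw [h2, h3, norm_mul, Real.log_mul (norm_ne_zero_iff.2 hp0)
      (norm_ne_zero_iff.2 (right_ne_zero_of_mul h1))]

/-- The Poisson integral of `log ‖x - t‖`. -/
theorem poisson_log_norm_sub (x : ℂ) (a : ℝ) {b : ℝ} (hb : 0 < b) :
    Integrable (fun t : ℝ => Real.log ‖x - t‖ * poisson a b t) ∧
    ∫ t : ℝ, Real.log ‖x - t‖ * poisson a b t = Real.pi *
      Real.log (max ‖x - (a - b * Complex.I)‖ ‖x - (a + b * Complex.I)‖) := by
  obtain ⟨s, v, hsv, hae⟩ := log_norm_sub_add_mul_tan_ae x a hb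
  have hle : -(Real.pi / 2) ≤ Real.pi / 2 := by linarith [Real.pi_pos]
  have hi1 := intervalIntegrable_log_norm_unitPt_two_mul_sub v (-(Real.pi / 2)) (Real.pi / 2)
  have hi2 := intervalIntegrable_log_norm_unitPt_two_mul_sub (-1) (-(Real.pi / 2)) (Real.pi / 2)
  have hi3 : IntervalIntegrable (fun _ : ℝ => s) volume (-(Real.pi / 2)) (Real.pi / 2) :=
    intervalIntegrable_const
  rw [integrable_mul_poisson_iff a hb fun t : ℝ => Real.log ‖x - t‖,
    integral_mul_poisson a hb fun t : ℝ => Real.log ‖x - t‖]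
  constructor
  · refine Integrable.congr ?_ hae.symm
    exact (intervalIntegrable_iff_integrableOn_Ioo_of_le hle).1 ((hi3.add hi1).sub hi2)
  · rw [integral_congr_ae hae, ← integral_Ioc_eq_integral_Ioo, ← intervalIntegral.integral_of_le hle,
      intervalIntegral.integral_sub (hi3.add hi1) hi2, intervalIntegral.integral_add hi3 hi1]
    have h2 : -(Real.pi / 2) + Real.pi = Real.pi / 2 := by ring
    have hval : ∀ c : ℂ, ∫ θ in -(Real.pi / 2)..Real.pi / 2, Real.log ‖unitPt (2 * θ) - c‖
        = Real.pi * Real.posLog ‖c‖ := fun c => by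
      have h := integral_log_norm_unitPt_two_mul_sub c (-(Real.pi / 2))
      rwa [h2] at h
    rw [← hsv, intervalIntegral.integral_const, hval, hval]
    simp
    ring

/-! ### `muR` as the average of the harmonic measures of the points of the unit circle -/

/-- The density of `muR`. -/
def rho (t : ℝ) : ℝ := 1 / (Real.pi ^ 2 * t) * Real.log |(t + 1) / (t - 1)|

lemma measurable_rho : Measurable rho := by unfold rho; fun_prop

lemma muR_eq : muR = volume.withDensity fun t => ENNReal.ofReal (rho t) := rfl

lemma ae_ne_zero_one_neg_one : ∀ᵐ t : ℝ, t ≠ 0 ∧ t ≠ 1 ∧ t ≠ -1 := by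
  have h : ∀ c : ℝ, ∀ᵐ t : ℝ, t ≠ c := fun c => by simp [ae_iff]
  filter_upwards [h 0, h 1, h (-1)] with t h0 h1 h2 using ⟨h0, h1, h2⟩

lemma poisson_denom_pos {t : ℝ} (h1 : t ≠ 1) (h2 : t ≠ -1) (θ : ℝ) :
    0 < (t - Real.cos θ) ^ 2 + Real.sin θ ^ 2 := by
  rcases (sq_nonneg (t - Real.cos θ)).lt_or_eq with h | h
  · positivity
  · have h3 : t = Real.cos θ := by
      have := pow_eq_zero_iff (two_ne_zero) |>.1 h.symm
      linarith
    rw [← h, zero_add, Real.sin_sq, ← h3]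
    have : t ^ 2 ≠ 1 := fun h => by
      rcases mul_eq_zero.1 (by linear_combination h : (t - 1) * (t + 1) = 0) with h | h
      · exact h1 (by linarith)
      · exact h2 (by linarith)
    have h4 : t ^ 2 ≤ 1 := h3 ▸ Real.cos_sq_le_one θ
    have := lt_of_le_of_ne h4 this
    linarith

lemma continuous_poisson_circle {t : ℝ} (h1 : t ≠ 1) (h2 : t ≠ -1) :
    Continuous fun θ => poisson (Real.cos θ) (Real.sin θ) t := by
  unfold poisson
  exact Real.continuous_sin.div (by fun_prop) fun θ => (poisson_denom_pos h1 h2 θ).ne'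

lemma integral_poisson_circle {t : ℝ} (h0 : t ≠ 0) (h1 : t ≠ 1) (h2 : t ≠ -1) :
    ∫ θ in 0..Real.pi, poisson (Real.cos θ) (Real.sin θ) t
      = 1 / t * Real.log |(t + 1) / (t - 1)| := by
  have hd : ∀ θ ∈ Set.uIcc 0 Real.pi, HasDerivAt
      (fun θ => Real.log ((t - Real.cos θ) ^ 2 + Real.sin θ ^ 2) / (2 * t))
      (poisson (Real.cos θ) (Real.sin θ) t) θ := fun θ _ => by
    have hp := poisson_denom_pos h1 h2 θ
    have h3 : HasDerivAt (fun θ => (t - Real.cos θ) ^ 2 + Real.sin θ ^ 2)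
        (2 * t * Real.sin θ) θ := by
      have := (((Real.hasDerivAt_cos θ).const_sub t).pow 2).add ((Real.hasDerivAt_sin θ).pow 2)
      refine this.congr_deriv ?_
      simp
      ring
    refine ((h3.log hp.ne').div_const (2 * t)).congr_deriv ?_
    unfold poisson
    field_simp
  rw [intervalIntegral.integral_eq_sub_of_hasDerivAt hd
    ((continuous_poisson_circle h1 h2).intervalIntegrable _ _)]
  have ha : t + 1 ≠ 0 := fun h => h2 (by linarith)
  have hb : t - 1 ≠ 0 := sub_ne_zero.2 h1
  rw [Real.log_abs, Real.log_div ha hb]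
  simp only [Real.cos_pi, Real.sin_pi, Real.cos_zero, Real.sin_zero, sub_neg_eq_add]
  rw [zero_pow two_ne_zero, add_zero, add_zero, Real.log_pow, Real.log_pow]
  field_simp
  push_cast
  ring

/-- `muR` is the harmonic measure of the real line averaged over the upper unit semicircle: one
factor 1/π normalizes the Poisson kernel, the other the average over θ. -/
lemma ofReal_rho_eq {t : ℝ} (h0 : t ≠ 0) (h1 : t ≠ 1) (h2 : t ≠ -1) :
    ENNReal.ofReal (rho t) = ∫⁻ θ in Set.Ioo 0 Real.pi,
      ENNReal.ofReal (1 / Real.pi ^ 2 * poisson (Real.cos θ) (Real.sin θ) t) := by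
  have hc := (continuous_poisson_circle h1 h2).const_mul (1 / Real.pi ^ 2)
  rw [← ofReal_integral_eq_lintegral_ofReal]
  · rw [← integral_Ioc_eq_integral_Ioo, ← intervalIntegral.integral_of_le Real.pi_pos.le,
      intervalIntegral.integral_const_mul, integral_poisson_circle h0 h1 h2, rho]
    congr 1
    field_simp
  · exact (hc.integrableOn_Icc (μ := volume)).mono_set Set.Ioo_subset_Icc_self
  · refine (ae_restrict_iff' measurableSet_Ioo).2 (ae_of_all _ fun θ hθ => ?_)
    exact mul_nonneg (by positivity)
      (poisson_nonneg (Real.sin_nonneg_of_nonneg_of_le_pi hθ.1.le hθ.2.le) _ _)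

lemma measurable_poisson_circle :
    Measurable fun p : ℝ × ℝ => poisson (Real.cos p.1) (Real.sin p.1) p.2 := by
  unfold poisson; fun_prop

/-- Tonelli's theorem, with G the harmonic extension of g evaluated at e^{iθ}. Nonnegativity of g
lets integrability under `muR` be derived rather than assumed. -/
theorem integral_muR_eq {g G : ℝ → ℝ} (hg : Measurable g) (hg0 : ∀ t, 0 ≤ g t)
    (hG : ∀ θ ∈ Set.Ioo 0 Real.pi,
      Integrable (fun t => g t * poisson (Real.cos θ) (Real.sin θ) t) ∧
      ∫ t, g t * poisson (Real.cos θ) (Real.sin θ) t = Real.pi * G θ)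
    (hGi : IntegrableOn G (Set.Ioo 0 Real.pi)) :
    Integrable g muR ∧ ∫ t, g t ∂muR = 1 / Real.pi * ∫ θ in Set.Ioo 0 Real.pi, G θ := by
  have hsin : ∀ θ ∈ Set.Ioo 0 Real.pi, 0 ≤ Real.sin θ := fun θ hθ =>
    Real.sin_nonneg_of_nonneg_of_le_pi hθ.1.le hθ.2.le
  have hG0 : ∀ θ ∈ Set.Ioo 0 Real.pi, 0 ≤ G θ := fun θ hθ => by
    have h : 0 ≤ ∫ t, g t * poisson (Real.cos θ) (Real.sin θ) t :=
      integral_nonneg fun t => mul_nonneg (hg0 t) (poisson_nonneg (hsin θ hθ) _ _)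
    rw [(hG θ hθ).2] at h
    exact nonneg_of_mul_nonneg_right h Real.pi_pos
  have key : ∫⁻ t, ENNReal.ofReal (g t) ∂muR
      = ENNReal.ofReal (1 / Real.pi * ∫ θ in Set.Ioo 0 Real.pi, G θ) := by
    rw [muR_eq, lintegral_withDensity_eq_lintegral_mul _ measurable_rho.ennreal_ofReal
      hg.ennreal_ofReal]
    calc ∫⁻ t, (ENNReal.ofReal (rho t) * ENNReal.ofReal (g t))
        = ∫⁻ t, ∫⁻ θ in Set.Ioo 0 Real.pi, ENNReal.ofReal
            (1 / Real.pi ^ 2 * poisson (Real.cos θ) (Real.sin θ) t) * ENNReal.ofReal (g t) := by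
          refine lintegral_congr_ae ?_
          filter_upwards [ae_ne_zero_one_neg_one] with t ht
          rw [ofReal_rho_eq ht.1 ht.2.1 ht.2.2, lintegral_mul_const]
          exact ((measurable_poisson_circle.comp measurable_prodMk_right).const_mul _).ennreal_ofReal
      _ = ∫⁻ θ in Set.Ioo 0 Real.pi, ∫⁻ t, ENNReal.ofReal
            (1 / Real.pi ^ 2 * poisson (Real.cos θ) (Real.sin θ) t) * ENNReal.ofReal (g t) := by
          refine lintegral_lintegral_swap (Measurable.aemeasurable ?_)
          exact ((measurable_poisson_circle.comp measurable_swap).const_mul _).ennreal_ofReal.mul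
            (hg.comp measurable_fst).ennreal_ofReal
      _ = ∫⁻ θ in Set.Ioo 0 Real.pi, ENNReal.ofReal (1 / Real.pi * G θ) := by
          refine setLIntegral_congr_fun measurableSet_Ioo fun θ hθ => ?_
          have h1 : ∀ t, ENNReal.ofReal (1 / Real.pi ^ 2 * poisson (Real.cos θ) (Real.sin θ) t)
              * ENNReal.ofReal (g t)
              = ENNReal.ofReal (1 / Real.pi ^ 2 *
                (g t * poisson (Real.cos θ) (Real.sin θ) t)) := fun t => by
            rw [← ENNReal.ofReal_mul' (hg0 t)]
            ring_nf
          simp_rw [h1]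
          rw [← ofReal_integral_eq_lintegral_ofReal ((hG θ hθ).1.const_mul _)
            (ae_of_all _ fun t => mul_nonneg (by positivity)
              (mul_nonneg (hg0 t) (poisson_nonneg (hsin θ hθ) _ _))),
            integral_const_mul, (hG θ hθ).2]
          congr 1
          field_simp
      _ = _ := by
          rw [← ofReal_integral_eq_lintegral_ofReal (hGi.const_mul _), integral_const_mul]
          exact (ae_restrict_iff' measurableSet_Ioo).2 (ae_of_all _ fun θ hθ =>
            mul_nonneg (by positivity) (hG0 θ hθ))
  have hval : 0 ≤ 1 / Real.pi * ∫ θ in Set.Ioo 0 Real.pi, G θ :=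
    mul_nonneg (by positivity) (setIntegral_nonneg measurableSet_Ioo hG0)
  constructor
  · rw [← lintegral_ofReal_ne_top_iff_integrable hg.aestronglyMeasurable (ae_of_all _ hg0), key]
    exact ENNReal.ofReal_ne_top
  · rw [integral_eq_lintegral_of_nonneg_ae (ae_of_all _ hg0) hg.aestronglyMeasurable, key,
      ENNReal.toReal_ofReal hval]

instance isProbabilityMeasure_muR : IsProbabilityMeasure muR := by
  have h := integral_muR_eq (g := fun _ => 1) (G := fun _ => 1) measurable_const
    (fun _ => zero_le_one) (fun θ hθ => ?_) (by simp)
  · have hf : IsFiniteMeasure muR := by simpa [integrable_const_iff_isFiniteMeasure] using h.1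
    have h2 := h.2
    simp [Real.pi_pos.le, Real.pi_pos.ne'] at h2
    constructor
    rw [← ENNReal.toReal_eq_one_iff]
    exact h2
  · have hs := Real.sin_pos_of_pos_of_lt_pi hθ.1 hθ.2
    simpa using ⟨integrable_poisson (Real.cos θ) hs, integral_poisson (Real.cos θ) hs⟩

/-! ### The logarithmic potential of `muR` -/

/-- Minus the logarithm of the chordal distance, up to a constant factor of the distance. -/
def chord (x y : ℂ) : ℝ :=
  1 / 2 * Real.log (1 + ‖x‖ ^ 2) + 1 / 2 * Real.log (1 + ‖y‖ ^ 2) - Real.log ‖x - y‖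

/-- Cauchy–Schwarz: (1 + a²)(1 + b²) - (a + b)² = (1 - ab)². -/
lemma norm_sub_sq_le (x y : ℂ) : ‖x - y‖ ^ 2 ≤ (1 + ‖x‖ ^ 2) * (1 + ‖y‖ ^ 2) := by
  have h := norm_sub_le x y
  have h0 := norm_nonneg (x - y)
  nlinarith [sq_nonneg (1 - ‖x‖ * ‖y‖), norm_nonneg x, norm_nonneg y]

lemma chord_nonneg (x y : ℂ) : 0 ≤ chord x y := by
  unfold chord
  rcases eq_or_ne x y with rfl | h
  · have := Real.log_nonneg (by nlinarith [sq_nonneg ‖x‖] : 1 ≤ 1 + ‖x‖ ^ 2)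
    simp only [sub_self, norm_zero, Real.log_zero]
    linarith
  · have h1 := Real.log_le_log (by have := norm_pos_iff.2 (sub_ne_zero.2 h); positivity)
      (norm_sub_sq_le x y)
    rw [Real.log_pow, Real.log_mul (by positivity) (by positivity)] at h1
    push_cast at h1
    linarith

lemma measurable_chord : Measurable fun p : ℂ × ℂ => chord p.1 p.2 := by
  unfold chord; fun_prop

/-- The Poisson integral of `log ‖x - ·‖` at `e ^ (i θ)`. -/
def logMax (x : ℂ) (θ : ℝ) : ℝ := Real.log (max ‖x - unitPt (-θ)‖ ‖x - unitPt θ‖)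

lemma unitPt_eq (θ : ℝ) : unitPt θ = Real.cos θ + Real.sin θ * Complex.I := by
  apply Complex.ext <;> simp [unitPt_re, unitPt_im, -Complex.ofReal_cos, -Complex.ofReal_sin]

lemma unitPt_neg_eq (θ : ℝ) : unitPt (-θ) = Real.cos θ - Real.sin θ * Complex.I := by
  rw [unitPt_eq, Real.cos_neg, Real.sin_neg]; push_cast; ring

/-- The points e^{±iθ} are 2 sin θ apart, so the larger distance to x is at least sin θ; log sin θ
and log(|x| + 1) then bracket the integrand. -/
lemma integrableOn_logMax (x : ℂ) : IntegrableOn (logMax x) (Set.Ioo 0 Real.pi) := by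
  have hls : IntegrableOn (Real.log ∘ Real.sin) (Set.Ioo 0 Real.pi) :=
    (intervalIntegrable_iff_integrableOn_Ioo_of_le Real.pi_pos.le).1 intervalIntegrable_log_sin
  have hm : Measurable (logMax x) := by
    unfold logMax
    refine Real.measurable_log.comp (Continuous.measurable ?_)
    have := continuous_unitPt
    fun_prop
  refine Integrable.mono' (hls.norm.add (integrable_const (Real.log (‖x‖ + 1))))
    hm.aestronglyMeasurable ?_
  refine (ae_restrict_iff' measurableSet_Ioo).2 (ae_of_all _ fun θ hθ => ?_)
  have hs := Real.sin_pos_of_pos_of_lt_pi hθ.1 hθ.2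
  have h1 : Real.sin θ ≤ max ‖x - unitPt (-θ)‖ ‖x - unitPt θ‖ := by
    have h : ‖unitPt θ - unitPt (-θ)‖ = 2 * Real.sin θ := by
      rw [unitPt_eq, unitPt_neg_eq, show (Real.cos θ : ℂ) + Real.sin θ * Complex.I
        - (Real.cos θ - Real.sin θ * Complex.I) = (2 * Real.sin θ : ℝ) * Complex.I by
          push_cast; ring, norm_mul, Complex.norm_I, mul_one, Complex.norm_real,
        Real.norm_of_nonneg (by positivity)]
    have h2 := norm_sub_le (x - unitPt (-θ)) (x - unitPt θ)
    rw [sub_sub_sub_cancel_left, h] at h2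
    linarith [le_max_left ‖x - unitPt (-θ)‖ ‖x - unitPt θ‖,
      le_max_right ‖x - unitPt (-θ)‖ ‖x - unitPt θ‖]
  have h2 : max ‖x - unitPt (-θ)‖ ‖x - unitPt θ‖ ≤ ‖x‖ + 1 := by
    refine max_le ?_ ?_ <;> refine (norm_sub_le _ _).trans ?_ <;> rw [norm_unitPt]
  have h3 := Real.log_le_log hs h1
  have h4 := Real.log_le_log (hs.trans_le h1) h2
  have h5 := neg_abs_le (Real.log (Real.sin θ))
  have h6 : 0 ≤ Real.log (‖x‖ + 1) := Real.log_nonneg (by linarith [norm_nonneg x])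
  have h7 := abs_nonneg (Real.log (Real.sin θ))
  simp only [Real.norm_eq_abs, Pi.add_apply, Function.comp_apply, logMax]
  rw [abs_le]
  constructor <;> linarith

lemma poisson_circle_log_norm_sub (x : ℂ) {θ : ℝ} (hθ : θ ∈ Set.Ioo 0 Real.pi) :
    Integrable (fun t : ℝ => Real.log ‖x - t‖ * poisson (Real.cos θ) (Real.sin θ) t) ∧
    ∫ t : ℝ, Real.log ‖x - t‖ * poisson (Real.cos θ) (Real.sin θ) t = Real.pi * logMax x θ := by
  have h := poisson_log_norm_sub x (Real.cos θ) (Real.sin_pos_of_pos_of_lt_pi hθ.1 hθ.2)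
  rwa [← unitPt_eq, ← unitPt_neg_eq] at h

lemma log_one_add_sq_eq (t : ℝ) :
    1 / 2 * Real.log (1 + ‖(t : ℂ)‖ ^ 2) = Real.log ‖Complex.I - t‖ := by
  have h : 1 + ‖(t : ℂ)‖ ^ 2 = ‖Complex.I - t‖ ^ 2 := by
    rw [← Complex.normSq_eq_norm_sq, ← Complex.normSq_eq_norm_sq]
    simp [Complex.normSq_apply]
    ring
  rw [h, Real.log_pow]
  push_cast
  ring

lemma integral_log_one_add_sq_muR :
    Integrable (fun t : ℝ => 1 / 2 * Real.log (1 + ‖(t : ℂ)‖ ^ 2)) muR ∧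
    ∫ t : ℝ, 1 / 2 * Real.log (1 + ‖(t : ℂ)‖ ^ 2) ∂muR
      = 1 / Real.pi * ∫ θ in Set.Ioo 0 Real.pi, logMax Complex.I θ := by
  have he : (fun t : ℝ => 1 / 2 * Real.log (1 + ‖(t : ℂ)‖ ^ 2))
      = fun t : ℝ => Real.log ‖Complex.I - t‖ := funext log_one_add_sq_eq
  rw [he]
  refine integral_muR_eq (g := fun t : ℝ => Real.log ‖Complex.I - t‖) (G := logMax Complex.I)
    (Measurable.log (by fun_prop)) (fun t => ?_)
    (fun θ hθ => poisson_circle_log_norm_sub Complex.I hθ) (integrableOn_logMax Complex.I)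
  have := Real.log_nonneg (by nlinarith [sq_nonneg ‖(t : ℂ)‖] : 1 ≤ 1 + ‖(t : ℂ)‖ ^ 2)
  rw [← log_one_add_sq_eq]
  linarith

/-- The chordal kernel is used because log|x - t| changes sign, whereas `integral_muR_eq` needs a
nonnegative integrand. The term ½ log(1 + t²) is log|i - t|, hence also covered by the Poisson
integral formula. -/
lemma integral_chord_muR (x : ℂ) :
    Integrable (fun t : ℝ => chord x t) muR ∧
    ∫ t : ℝ, chord x t ∂muR = 1 / Real.pi * ∫ θ in Set.Ioo 0 Real.pi,
      (1 / 2 * Real.log (1 + ‖x‖ ^ 2) + logMax Complex.I θ - logMax x θ) := by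
  have hm : Measurable fun t : ℝ => chord x t := by unfold chord; fun_prop
  refine integral_muR_eq hm (fun t => chord_nonneg _ _) (fun θ hθ => ?_)
    (((integrable_const _).add (integrableOn_logMax Complex.I)).sub (integrableOn_logMax x))
  have h0 := integrable_poisson (Real.cos θ) (Real.sin_pos_of_pos_of_lt_pi hθ.1 hθ.2)
  have h0' := integral_poisson (Real.cos θ) (Real.sin_pos_of_pos_of_lt_pi hθ.1 hθ.2)
  have h1 := poisson_circle_log_norm_sub Complex.I hθ
  have h2 := poisson_circle_log_norm_sub x hθ
  have h3 := h0.const_mul (1 / 2 * Real.log (1 + ‖x‖ ^ 2))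
  have he : ∀ t : ℝ, chord x t * poisson (Real.cos θ) (Real.sin θ) t
      = 1 / 2 * Real.log (1 + ‖x‖ ^ 2) * poisson (Real.cos θ) (Real.sin θ) t
        + Real.log ‖Complex.I - t‖ * poisson (Real.cos θ) (Real.sin θ) t
        - Real.log ‖x - t‖ * poisson (Real.cos θ) (Real.sin θ) t := fun t => by
    rw [chord, log_one_add_sq_eq]; ring
  simp_rw [he]
  refine ⟨(h3.add h1.1).sub h2.1, ?_⟩
  have e1 := integral_sub (h3.add h1.1) h2.1
  have e2 := integral_add h3 h1.1
  simp only [Pi.add_apply] at e1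
  rw [e1, e2, integral_const_mul, h0', h1.2, h2.2]
  ring

/-- The mean value of `½ log (1 + t²)` under `muR`. -/
def meanLog : ℝ := ∫ t : ℝ, 1 / 2 * Real.log (1 + ‖(t : ℂ)‖ ^ 2) ∂muR

/-- The logarithmic potential of `muR`. -/
def potential (x : ℂ) : ℝ := 1 / Real.pi * ∫ θ in Set.Ioo 0 Real.pi, logMax x θ

lemma integral_chord_muR_eq (x : ℂ) :
    ∫ t : ℝ, chord x t ∂muR = meanLog + 1 / 2 * Real.log (1 + ‖x‖ ^ 2) - potential x := by
  have h1 : IntegrableOn (fun _ : ℝ => 1 / 2 * Real.log (1 + ‖x‖ ^ 2)) (Set.Ioo 0 Real.pi) :=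
    integrable_const _
  have e1 := integral_sub (h1.add (integrableOn_logMax Complex.I)) (integrableOn_logMax x)
  have e2 := integral_add h1 (integrableOn_logMax Complex.I)
  simp only [Pi.add_apply] at e1
  rw [(integral_chord_muR x).2, e1, e2, meanLog, integral_log_one_add_sq_muR.2, potential]
  simp only [integral_const, MeasurableSet.univ, measureReal_restrict_apply, Set.univ_inter,
    Real.volume_real_Ioo_of_le Real.pi_pos.le, sub_zero, smul_eq_mul]
  field_simp
  ring

/-! ### The potential on the real line -/

lemma integrableOn_log_norm_sub_unitPt (x : ℂ) :
    IntegrableOn (fun θ => Real.log ‖x - unitPt θ‖) (Set.Ioo 0 Real.pi) ∧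
    IntegrableOn (fun θ => Real.log ‖x - unitPt (-θ)‖) (Set.Ioo 0 Real.pi) := by
  constructor
  · rw [← intervalIntegrable_iff_integrableOn_Ioo_of_le Real.pi_pos.le]
    simpa only [norm_sub_rev] using intervalIntegrable_log_norm_unitPt_sub x 0 Real.pi
  · rw [← intervalIntegrable_iff_integrableOn_Ioo_of_le Real.pi_pos.le]
    have h := intervalIntegrable_log_norm_unitPt_sub (starRingEnd ℂ x) 0 Real.pi
    refine h.congr fun θ _ => ?_
    rw [unitPt_neg, ← Complex.norm_conj (x - _), map_sub, Complex.conj_conj, norm_sub_rev]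

lemma integral_log_norm_sub_unitPt (x : ℂ) :
    ∫ θ in Set.Ioo 0 Real.pi, (1 / 2 * (Real.log ‖x - unitPt θ‖ + Real.log ‖x - unitPt (-θ)‖))
      = Real.pi * Real.posLog ‖x‖ := by
  have hi := integrableOn_log_norm_sub_unitPt x
  rw [integral_const_mul, integral_add hi.1 hi.2, ← integral_Ioc_eq_integral_Ioo,
    ← integral_Ioc_eq_integral_Ioo, ← intervalIntegral.integral_of_le Real.pi_pos.le,
    ← intervalIntegral.integral_of_le Real.pi_pos.le]
  have h1 : ∫ θ in 0..Real.pi, Real.log ‖x - unitPt (-θ)‖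
      = ∫ θ in -Real.pi..0, Real.log ‖x - unitPt θ‖ := by
    simpa using intervalIntegral.integral_comp_neg (a := 0) (b := Real.pi)
      fun θ => Real.log ‖x - unitPt θ‖
  have hkey := intervalIntegrable_log_norm_unitPt_sub x
  simp_rw [norm_sub_rev x] at h1 ⊢
  rw [h1, add_comm, intervalIntegral.integral_add_adjacent_intervals (hkey _ _) (hkey _ _)]
  have h2 := integral_log_norm_unitPt_sub x (-Real.pi)
  rw [show -Real.pi + 2 * Real.pi = Real.pi by ring] at h2
  rw [h2]
  ring

/-- For real t the points e^{±iθ} are equidistant, so the logarithm of the maximum equals the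
average of the two logarithms and the half-circle integral unfolds to a full circle mean, to which
Jensen's formula applies. -/
lemma potential_ofReal (t : ℝ) : potential t = Real.posLog |t| := by
  have h : ∀ θ, logMax t θ
      = 1 / 2 * (Real.log ‖(t : ℂ) - unitPt θ‖ + Real.log ‖(t : ℂ) - unitPt (-θ)‖) := fun θ => by
    have : ‖(t : ℂ) - unitPt (-θ)‖ = ‖(t : ℂ) - unitPt θ‖ := by
      rw [← Complex.norm_conj, map_sub, Complex.conj_ofReal, unitPt_neg, Complex.conj_conj]
    rw [logMax, this, max_self]
    ring
  rw [potential]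
  simp_rw [h]
  rw [integral_log_norm_sub_unitPt, Complex.norm_real, Real.norm_eq_abs]
  field_simp

lemma potential_conj (x : ℂ) : potential (starRingEnd ℂ x) = potential x := by
  have h : ∀ θ, logMax (starRingEnd ℂ x) θ = logMax x θ := fun θ => by
    have h1 : ∀ θ, ‖starRingEnd ℂ x - unitPt θ‖ = ‖x - unitPt (-θ)‖ := fun θ => by
      rw [unitPt_neg, ← Complex.norm_conj (starRingEnd ℂ x - _), map_sub, Complex.conj_conj]
    rw [logMax, logMax, h1, h1, neg_neg, max_comm]
  simp_rw [potential, h]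

/-! ### The potential off the real line -/

lemma ae_unitPt_two_mul_ne (v : ℂ) :
    ∀ᵐ θ ∂(volume.restrict (Set.Ioo 0 Real.pi)), θ ∈ Set.Ioo 0 Real.pi ∧ unitPt (2 * θ) ≠ v := by
  rw [ae_restrict_iff' measurableSet_Ioo, ae_iff]
  refine Set.Subsingleton.measure_zero ?_ _
  intro θ hθ φ hφ
  simp only [Set.mem_ofPred_eq, Classical.not_imp, not_and, not_not] at hθ hφ
  have h := (hθ.2 hθ.1).trans (hφ.2 hφ.1).symm
  obtain ⟨n, hn⟩ := Complex.exp_eq_exp_iff_exists_int.1 h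
  have h2 : 2 * θ = 2 * φ + n * (2 * Real.pi) := by
    have h3 : ((2 * θ : ℝ) : ℂ) * Complex.I
        = ((2 * φ + n * (2 * Real.pi) : ℝ) : ℂ) * Complex.I := by
      rw [hn]; push_cast; ring
    exact_mod_cast mul_right_cancel₀ Complex.I_ne_zero h3
  obtain ⟨⟨a1, a2⟩, -⟩ := hθ
  obtain ⟨⟨b1, b2⟩, -⟩ := hφ
  have hp := Real.pi_pos
  have hn1 : (n : ℝ) < 1 := by
    by_contra h; nlinarith [not_lt.1 h]
  have hn2 : (-1 : ℝ) < n := by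
    by_contra h; nlinarith [not_lt.1 h]
  have hn0 : n = 0 := by
    have h1 : n < 1 := by exact_mod_cast hn1
    have h2 : -1 < n := by exact_mod_cast hn2
    omega
  rw [hn0] at h2
  simp at h2
  exact h2

/-- The distance from a point of the unit circle to a ray bounds its distance to any point of
the ray from below. -/
lemma norm_sq_sub_sq_le {v w : ℂ} (hv : ‖v‖ = 1) (hw : ‖w‖ = 1) (r : ℝ) :
    ‖w ^ 2 - v ^ 2‖ ≤ 2 * ‖r * v - w‖ := by
  -- Rotation by the conjugate of v carries the line through v to the real axis; for a unit number
  -- z, |z² - 1| = 2|Im z|, and |Im z| is the distance from z to that axis.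
  set z := w * starRingEnd ℂ v with hz
  have hvv : v * starRingEnd ℂ v = 1 := by rw [Complex.mul_conj, Complex.normSq_eq_norm_sq, hv]; simp
  have hzz : z * starRingEnd ℂ z = 1 := by
    rw [Complex.mul_conj, Complex.normSq_eq_norm_sq, hz, norm_mul, Complex.norm_conj, hv, hw]; simp
  have hwz : w = z * v := by rw [hz]; linear_combination -w * hvv
  have h1 : w ^ 2 - v ^ 2 = v ^ 2 * z * (z - starRingEnd ℂ z) := by
    rw [hwz]; linear_combination v ^ 2 * hzz
  have hz1 : ‖z‖ = 1 := by rw [hz, norm_mul, Complex.norm_conj, hv, hw, one_mul]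
  have h2 : ‖w ^ 2 - v ^ 2‖ = 2 * |z.im| := by
    rw [h1, norm_mul, norm_mul, norm_pow, hv, hz1, Complex.sub_conj, norm_mul, Complex.norm_I,
      Complex.norm_real]
    simp
  have h3 : ‖r * v - w‖ = ‖(r : ℂ) - z‖ := by
    rw [hwz, ← sub_mul, norm_mul, hv, mul_one]
  have h4 : |z.im| ≤ ‖(r : ℂ) - z‖ := by
    have := Complex.abs_im_le_norm ((r : ℂ) - z)
    simpa using this
  rw [h2, h3]
  linarith

lemma norm_sub_mul_sq {v z : ℂ} (hv : ‖v‖ = 1) (hz : ‖z‖ = 1) (R : ℝ) :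
    ‖z - R * v‖ ^ 2 = (R - 1) ^ 2 + R * ‖z - v‖ ^ 2 := by
  have h1 : v.re ^ 2 + v.im ^ 2 = 1 := by
    have := Complex.normSq_eq_norm_sq v
    rw [hv, Complex.normSq_apply] at this; linarith
  have h2 : z.re ^ 2 + z.im ^ 2 = 1 := by
    have := Complex.normSq_eq_norm_sq z
    rw [hz, Complex.normSq_apply] at this; linarith
  rw [← Complex.normSq_eq_norm_sq, ← Complex.normSq_eq_norm_sq, Complex.normSq_apply,
    Complex.normSq_apply]
  simp
  linear_combination (R ^ 2 - R) * h1 + (1 - R) * h2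

/-- This is the square of 2s ≤ sinh 2s, since e^{4s} - 1 = 2 e^{2s} sinh 2s. It explains the choice
R = e^{4s} below. -/
lemma sixteen_mul_le {s : ℝ} (hs : 0 ≤ s) :
    16 * s ^ 2 * Real.exp (4 * s) ≤ (Real.exp (4 * s) - 1) ^ 2 := by
  have h1 : 2 * s ≤ Real.sinh (2 * s) := Real.self_le_sinh_iff.2 (by linarith)
  have h2 : Real.exp (4 * s) = Real.exp (2 * s) ^ 2 := by rw [← Real.exp_nat_mul]; ring_nf
  have h3 : Real.exp (4 * s) - 1 = 2 * Real.exp (2 * s) * Real.sinh (2 * s) := by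
    have h : Real.exp (2 * s) * Real.exp (-(2 * s)) = 1 := by rw [← Real.exp_add]; simp
    rw [Real.sinh_eq, h2]
    linear_combination h
  rw [h3, mul_pow, h2]
  have h4 : (2 * s) ^ 2 ≤ Real.sinh (2 * s) ^ 2 := pow_le_pow_left₀ (by linarith) h1 2
  nlinarith [sq_nonneg (Real.exp (2 * s))]

/-- Let n ≤ m be the distances from x to e^{iθ} and e^{-iθ}, and d = |e^{2iθ} - v²|, where v is the
direction of x. Then (m/n)² = 1 + 4 Im x sin θ / n², and d ≤ 2n bounds this by 1 + 16 s²/d². With R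
= e^{4s} the latter is at most ((R - 1)² + R d²)/(R d²) = |e^{2iθ} - R v²|²/(R d²). Taking
logarithms replaces the maximum by quantities whose circle means are known. -/
lemma logMax_le {x : ℂ} {s θ : ℝ} (hs : 0 ≤ s) (hx0 : 0 ≤ x.im) (hx1 : x.im ≤ s ^ 2)
    (hθ : θ ∈ Set.Ioo 0 Real.pi) {v : ℂ} (hv : ‖v‖ = 1) (hxv : x = ‖x‖ * v)
    (hne : unitPt (2 * θ) ≠ v ^ 2) :
    logMax x θ ≤ 1 / 2 * (Real.log ‖x - unitPt θ‖ + Real.log ‖x - unitPt (-θ)‖)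
      + (1 / 2 * Real.log ‖unitPt (2 * θ) - (Real.exp (4 * s) : ℝ) * v ^ 2‖ - s
        - 1 / 2 * Real.log ‖unitPt (2 * θ) - v ^ 2‖) := by
  have hsin := Real.sin_pos_of_pos_of_lt_pi hθ.1 hθ.2
  set R := Real.exp (4 * s) with hR
  have hRpos : 0 < R := Real.exp_pos _
  have hv2 : ‖v ^ 2‖ = 1 := by rw [norm_pow, hv, one_pow]
  have hd : 0 < ‖unitPt (2 * θ) - v ^ 2‖ := norm_pos_iff.2 (sub_ne_zero.2 hne)
  have h2n : ‖unitPt (2 * θ) - v ^ 2‖ ≤ 2 * ‖x - unitPt θ‖ := by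
    have := norm_sq_sub_sq_le hv (norm_unitPt θ) ‖x‖
    rwa [← hxv, sq (unitPt θ), ← unitPt_add, ← two_mul] at this
  have hn : 0 < ‖x - unitPt θ‖ := by linarith
  have hmn : ‖x - unitPt (-θ)‖ ^ 2 = ‖x - unitPt θ‖ ^ 2 + 4 * x.im * Real.sin θ := by
    rw [← Complex.normSq_eq_norm_sq, ← Complex.normSq_eq_norm_sq, Complex.normSq_apply,
      Complex.normSq_apply]
    simp [unitPt_re, unitPt_im]
    ring
  have hm : ‖x - unitPt θ‖ ≤ ‖x - unitPt (-θ)‖ := by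
    refine le_of_sq_le_sq ?_ (norm_nonneg _)
    rw [hmn]
    nlinarith [mul_nonneg hx0 hsin.le]
  have hm0 : 0 < ‖x - unitPt (-θ)‖ := hn.trans_le hm
  have hRv := norm_sub_mul_sq hv2 (norm_unitPt (2 * θ)) R
  have hR16 := sixteen_mul_le hs
  rw [← hR] at hR16
  have hkey : ‖x - unitPt (-θ)‖ ^ 2 * (R * ‖unitPt (2 * θ) - v ^ 2‖ ^ 2)
      ≤ ‖x - unitPt θ‖ ^ 2 * ‖unitPt (2 * θ) - R * v ^ 2‖ ^ 2 := by
    rw [hRv, hmn]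
    have h1 : 4 * x.im * Real.sin θ ≤ 4 * s ^ 2 := by nlinarith [Real.sin_le_one θ]
    have h2 : ‖unitPt (2 * θ) - v ^ 2‖ ^ 2 ≤ 4 * ‖x - unitPt θ‖ ^ 2 := by nlinarith
    have h3 : 4 * x.im * Real.sin θ * (R * ‖unitPt (2 * θ) - v ^ 2‖ ^ 2)
        ≤ 4 * s ^ 2 * (R * (4 * ‖x - unitPt θ‖ ^ 2)) := by gcongr
    nlinarith [mul_le_mul_of_nonneg_left hR16 (sq_nonneg ‖x - unitPt θ‖)]
  have hRv0 : 0 < ‖unitPt (2 * θ) - R * v ^ 2‖ := by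
    by_contra h
    have h0 : ‖unitPt (2 * θ) - R * v ^ 2‖ = 0 := le_antisymm (not_lt.1 h) (norm_nonneg _)
    rw [h0] at hRv
    nlinarith [sq_nonneg (R - 1), mul_pos hRpos (pow_pos hd 2)]
  have hlog := Real.log_le_log (by positivity) hkey
  rw [Real.log_mul (by positivity) (by positivity), Real.log_mul (by positivity) (by positivity),
    Real.log_mul (by positivity) (by positivity), Real.log_pow, Real.log_pow, Real.log_pow,
    Real.log_pow, hR, Real.log_exp, ← hR] at hlog
  push_cast at hlog
  rw [logMax, max_eq_left hm]
  linarith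

/-- Integrate the pointwise bound: the symmetric part has mean log⁺|x|, and the correction has mean
½ log⁺ R - s - ½ log⁺ 1 = 2s - s = s. -/
lemma potential_le_of_im_nonneg {x : ℂ} {s : ℝ} (hs : 0 ≤ s) (hx0 : 0 ≤ x.im)
    (hx1 : x.im ≤ s ^ 2) : potential x ≤ Real.posLog ‖x‖ + s := by
  set v := unitPt x.arg with hvdef
  have hv : ‖v‖ = 1 := norm_unitPt _
  have hxv : x = ‖x‖ * v := (Complex.norm_mul_exp_arg_mul_I x).symm
  have hv2 : ‖v ^ 2‖ = 1 := by rw [norm_pow, hv, one_pow]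
  set R := Real.exp (4 * s) with hR
  have hi := integrableOn_log_norm_sub_unitPt x
  have hI1 : IntegrableOn (fun θ => 1 / 2 * (Real.log ‖x - unitPt θ‖
      + Real.log ‖x - unitPt (-θ)‖)) (Set.Ioo 0 Real.pi) := (hi.1.add hi.2).const_mul _
  have hc : ∀ a : ℂ, IntegrableOn (fun θ => 1 / 2 * Real.log ‖unitPt (2 * θ) - a‖)
      (Set.Ioo 0 Real.pi) ∧ ∫ θ in Set.Ioo 0 Real.pi, 1 / 2 * Real.log ‖unitPt (2 * θ) - a‖
        = 1 / 2 * (Real.pi * Real.posLog ‖a‖) := fun a => by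
    constructor
    · exact ((intervalIntegrable_iff_integrableOn_Ioo_of_le Real.pi_pos.le).1
        (intervalIntegrable_log_norm_unitPt_two_mul_sub a 0 Real.pi)).const_mul _
    · rw [integral_const_mul, ← integral_Ioc_eq_integral_Ioo,
        ← intervalIntegral.integral_of_le Real.pi_pos.le]
      have := integral_log_norm_unitPt_two_mul_sub a 0
      rw [zero_add] at this
      rw [this]
  have hs' : IntegrableOn (fun _ : ℝ => s) (Set.Ioo 0 Real.pi) := integrable_const _
  have hA := (hc (R * v ^ 2))
  have hB := (hc (v ^ 2))
  have hle : ∫ θ in Set.Ioo 0 Real.pi, logMax x θ ≤ _ :=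
    integral_mono_ae (integrableOn_logMax x) (hI1.add ((hA.1.sub hs').sub hB.1)) (by
      filter_upwards [ae_unitPt_two_mul_ne (v ^ 2)] with θ hθ
      exact logMax_le hs hx0 hx1 hθ.1 hv hxv hθ.2)
  have e1 := integral_add hI1 ((hA.1.sub hs').sub hB.1)
  have e2 := integral_sub (hA.1.sub hs') hB.1
  have e3 := integral_sub hA.1 hs'
  simp only [Pi.add_apply, Pi.sub_apply] at e1 e2 e3 hle
  rw [e1, e2, e3, integral_log_norm_sub_unitPt, hA.2, hB.2] at hle
  have hR1 : 1 ≤ R := Real.one_le_exp (by linarith)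
  have hRn : Real.posLog ‖(R : ℂ) * v ^ 2‖ = 4 * s := by
    rw [norm_mul, hv2, mul_one, Complex.norm_real, Real.norm_of_nonneg (by linarith),
      Real.posLog_eq_log (by rwa [abs_of_nonneg (by linarith)]), hR, Real.log_exp]
  have hv1 : Real.posLog ‖v ^ 2‖ = 0 := by rw [hv2]; simp
  rw [hRn, hv1] at hle
  simp only [integral_const, MeasurableSet.univ, measureReal_restrict_apply, Set.univ_inter,
    Real.volume_real_Ioo_of_le Real.pi_pos.le, sub_zero, smul_eq_mul] at hle
  rw [potential, one_div, inv_mul_le_iff₀ Real.pi_pos]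
  linarith

/-- Off the real line the potential of `muR` exceeds `log⁺ ‖x‖` by at most `√|Im x|`. -/
theorem potential_le {x : ℂ} {ε : ℝ} (hx : |x.im| ≤ ε) :
    potential x ≤ Real.posLog ‖x‖ + Real.sqrt ε := by
  have hε : 0 ≤ ε := (abs_nonneg _).trans hx
  have h2 : Real.sqrt ε ^ 2 = ε := Real.sq_sqrt hε
  rcases le_total 0 x.im with h | h
  · exact potential_le_of_im_nonneg (Real.sqrt_nonneg ε) h (by rw [h2]; exact (le_abs_self _).trans hx)
  · rw [← potential_conj, ← Complex.norm_conj]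
    refine potential_le_of_im_nonneg (Real.sqrt_nonneg ε) (by simpa using h) ?_
    rw [h2, Complex.conj_im]
    exact (neg_le_abs _).trans hx

/-! ### Moments of powers of the logarithm -/

lemma integral_pow_mul_exp_neg_mul (m : ℕ) {r : ℝ} (hr : 0 < r) :
    ∫ t in Set.Ioi (0 : ℝ), t ^ m * Real.exp (-(r * t)) = m.factorial / r ^ (m + 1) := by
  have h := Real.integral_rpow_mul_exp_neg_mul_Ioi (a := m + 1) (by positivity) hr
  rw [Real.Gamma_nat_eq_factorial] at h
  simp only [add_sub_cancel_right, Real.rpow_natCast] at h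
  rw [h, show (m : ℝ) + 1 = ((m + 1 : ℕ) : ℝ) by push_cast; rfl, Real.rpow_natCast,
    one_div, inv_pow]
  field_simp

lemma image_exp_neg : (fun t => Real.exp (-t)) '' Set.Ioi 0 = Set.Ioo 0 1 := by
  ext q
  constructor
  · rintro ⟨t, ht, rfl⟩
    exact ⟨Real.exp_pos _, Real.exp_lt_one_iff.2 (by simpa using ht)⟩
  · rintro ⟨h0, h1⟩
    exact ⟨-Real.log q, by simpa using Real.log_neg h0 h1, by simp [Real.exp_log h0]⟩

lemma integral_neg_log_pow_mul_pow (m n : ℕ) :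
    ∫ q in Set.Ioo (0 : ℝ) 1, (-Real.log q) ^ m * q ^ n = m.factorial / (n + 1 : ℝ) ^ (m + 1) := by
  rw [← image_exp_neg, integral_image_eq_integral_abs_deriv_smul (f' := fun t => -Real.exp (-t))
    measurableSet_Ioi, ← integral_pow_mul_exp_neg_mul m (by positivity : (0 : ℝ) < n + 1)]
  · refine setIntegral_congr_fun measurableSet_Ioi fun t _ => ?_
    simp only [abs_neg, abs_of_pos (Real.exp_pos _), smul_eq_mul, Real.log_exp, neg_neg]
    rw [← Real.exp_nat_mul, mul_left_comm, ← Real.exp_add]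
    ring_nf
  · intro t _
    simpa using ((hasDerivAt_neg t).exp).hasDerivWithinAt
  · intro t _ s _ h
    simpa using h

lemma integrableOn_neg_log_pow_mul_pow (m n : ℕ) :
    IntegrableOn (fun q : ℝ => (-Real.log q) ^ m * q ^ n) (Set.Ioo 0 1) := by
  -- A non-integrable function has Bochner integral 0, so the positive value just computed already
  -- yields integrability.
  refine Integrable.of_integral_ne_zero ?_
  rw [integral_neg_log_pow_mul_pow]
  positivity

lemma neg_log_pos_of_mem {q : ℝ} (hq : q ∈ Set.Ioo (0 : ℝ) 1) : 0 < -Real.log q := by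
  linarith [Real.log_neg hq.1 hq.2]

lemma summable_one_div_odd_pow (m n : ℕ) :
    Summable fun j : ℕ => ((m + 1).factorial : ℝ) / (n + 2 * j + 1 : ℝ) ^ (m + 2) := by
  have h : Summable fun j : ℕ => 1 / ((j : ℝ) + 1) ^ (m + 2) := by
    have := (summable_nat_add_iff 1).2 (Real.summable_one_div_nat_pow.2 (by omega : 1 < m + 2))
    simpa using this
  refine Summable.of_nonneg_of_le (fun j => by positivity) (fun j => ?_)
    (h.mul_left ((m + 1).factorial : ℝ))
  rw [mul_one_div]
  gcongr
  have : (0 : ℝ) ≤ n := n.cast_nonneg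
  have : (0 : ℝ) ≤ j := j.cast_nonneg
  linarith

/-- Expand 1/(1 - q²) as a geometric series and integrate term by term. -/
lemma hasSum_integral_logMoment (m n : ℕ) :
    HasSum (fun j : ℕ => ((m + 1).factorial : ℝ) / (n + 2 * j + 1 : ℝ) ^ (m + 2))
      (∫ q in Set.Ioo (0 : ℝ) 1, (-Real.log q) ^ (m + 1) / (1 - q ^ 2) * q ^ n) := by
  have hval : ∀ j : ℕ, ∫ q in Set.Ioo (0 : ℝ) 1, (-Real.log q) ^ (m + 1) * q ^ (n + 2 * j)
      = ((m + 1).factorial : ℝ) / (n + 2 * j + 1 : ℝ) ^ (m + 2) := fun j => by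
    rw [integral_neg_log_pow_mul_pow]; push_cast; rfl
  have h := hasSum_integral_of_summable_integral_norm
    (fun j : ℕ => integrableOn_neg_log_pow_mul_pow (m + 1) (n + 2 * j)) ?_
  · simp_rw [hval] at h
    refine (congrArg (HasSum _) ?_).mpr h
    refine setIntegral_congr_fun measurableSet_Ioo fun q hq => ?_
    have hq2 : q ^ 2 < 1 := by nlinarith [hq.1, hq.2]
    have h1 := (hasSum_geometric_of_lt_one (sq_nonneg q) hq2).mul_left
      ((-Real.log q) ^ (m + 1) * q ^ n)
    rw [div_mul_eq_mul_div, div_eq_mul_inv, ← h1.tsum_eq]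
    congr 1
    ext j
    rw [pow_add q, pow_mul]
    ring
  · refine (summable_one_div_odd_pow m n).congr fun j => ?_
    rw [← hval j]
    refine setIntegral_congr_fun measurableSet_Ioo fun q hq => ?_
    have := (neg_log_pos_of_mem hq).le
    have := hq.1.le
    exact (Real.norm_of_nonneg (by positivity)).symm

lemma integrableOn_logMoment (m n : ℕ) :
    IntegrableOn (fun q : ℝ => (-Real.log q) ^ (m + 1) / (1 - q ^ 2) * q ^ n) (Set.Ioo 0 1) := by
  refine Integrable.of_integral_ne_zero ?_
  rw [← (hasSum_integral_logMoment m n).tsum_eq]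
  refine ((summable_one_div_odd_pow m n).tsum_pos (fun j => by positivity) 0 ?_).ne'
  positivity

/-! ### Sums over odd and even numbers -/

/-- `ζ(3)` as a real number. -/
def zetaThree : ℝ := ∑' n : ℕ, 1 / (n : ℝ) ^ 3

lemma riemannZeta_three_re : (riemannZeta 3).re = zetaThree := by
  have h : riemannZeta 3 = ((zetaThree : ℝ) : ℂ) := by
    have := zeta_nat_eq_tsum_of_gt_one (k := 3) (by norm_num)
    rw [zetaThree]
    push_cast at this ⊢
    exact this
  rw [h, Complex.ofReal_re]

lemma hasSum_even_odd {s : ℝ} {k : ℕ} (hk : k ≠ 0) (h : HasSum (fun n : ℕ => 1 / (n : ℝ) ^ k) s) :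
    HasSum (fun j : ℕ => 1 / (2 * j + 2 : ℝ) ^ k) (s / 2 ^ k) ∧
    HasSum (fun j : ℕ => 1 / (2 * j + 1 : ℝ) ^ k) (s - s / 2 ^ k) := by
  have he : HasSum (fun j : ℕ => 1 / ((2 * j : ℕ) : ℝ) ^ k) (s / 2 ^ k) := by
    refine (h.div_const (2 ^ k)).congr_fun fun j => ?_
    push_cast
    rw [mul_pow, div_div, mul_comm]
  have hs : Summable fun j : ℕ => 1 / ((2 * j + 1 : ℕ) : ℝ) ^ k :=
    h.summable.comp_injective (i := fun j : ℕ => 2 * j + 1) fun a b hab => by simpa using hab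
  constructor
  · have h1 := (hasSum_nat_add_iff' 1).2 he
    simp only [Finset.range_one, Finset.sum_singleton, mul_zero, Nat.cast_zero, zero_pow hk,
      div_zero, sub_zero] at h1
    refine h1.congr_fun fun j => ?_
    push_cast
    rw [mul_add, mul_one]
  · have h2 := HasSum.even_add_odd (f := fun n : ℕ => 1 / (n : ℝ) ^ k) he hs.hasSum
    have h4 : s - s / 2 ^ k = ∑' j : ℕ, 1 / ((2 * j + 1 : ℕ) : ℝ) ^ k := by
      linarith [h.unique h2]
    rw [h4]
    refine hs.hasSum.congr_fun fun j => ?_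
    push_cast
    rfl

lemma hasSum_zetaThree : HasSum (fun n : ℕ => 1 / (n : ℝ) ^ 3) zetaThree :=
  (Real.summable_one_div_nat_pow.2 (by norm_num)).hasSum

/-! ### Integrals against `muR` over the unit interval -/

lemma rho_neg (t : ℝ) : rho (-t) = rho t := by
  unfold rho
  have h : |(-t + 1) / (-t - 1)| = |(t + 1) / (t - 1)|⁻¹ := by
    rw [← abs_inv, inv_div, ← neg_div_neg_eq]
    congr 2 <;> ring
  rw [h, Real.log_inv]
  ring

lemma rho_inv {z : ℝ} (hz : 0 < z) : |-(z ^ 2)⁻¹| * rho z⁻¹ = rho z := by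
  unfold rho
  have h : |(z⁻¹ + 1) / (z⁻¹ - 1)| = |(z + 1) / (z - 1)| := by
    have h1 : z⁻¹ + 1 = (z + 1) * z⁻¹ := by field_simp; ring
    have h2 : z⁻¹ - 1 = (1 - z) * z⁻¹ := by field_simp
    rw [h1, h2, mul_div_mul_right _ _ (by positivity), abs_div, abs_div, abs_sub_comm]
  rw [h, abs_neg, abs_of_pos (by positivity)]
  field_simp

/-- Evenness of the density and invariance of `muR` under t ↦ 1/t fold the real line onto (0, 1),
each z standing for the four points ±z, ±1/z. -/
lemma lintegral_muR_fold {F : ℝ → ENNReal} (hF : Measurable F) :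
    ∫⁻ t, F t ∂muR = ∫⁻ z in Set.Ioo (0 : ℝ) 1,
      ENNReal.ofReal (rho z) * ((F z + F (-z)) + (F z⁻¹ + F (-z⁻¹))) := by
  have hr := measurable_rho.ennreal_ofReal
  rw [muR_eq, lintegral_withDensity_eq_lintegral_mul _ hr hF]
  set H : ℝ → ENNReal := fun t => ENNReal.ofReal (rho t) * (F t + F (-t)) with hH
  have hHm : Measurable H := hr.mul (hF.add (hF.comp measurable_neg))
  have h1 : ∫⁻ t, ENNReal.ofReal (rho t) * F t = ∫⁻ t in Set.Ioi (0 : ℝ), H t := by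
    have hc : (Set.Ioi (0 : ℝ))ᶜ = Set.Iic 0 := Set.compl_Ioi
    rw [← lintegral_add_compl _ (measurableSet_Ioi (a := (0 : ℝ))), hc,
      setLIntegral_congr Iio_ae_eq_Iic.symm]
    have h2 := (Measure.measurePreserving_neg (volume : Measure ℝ)).setLIntegral_comp_preimage_emb
      (MeasurableEquiv.neg ℝ).measurableEmbedding
      (fun t => ENNReal.ofReal (rho t) * F t) (Set.Iio 0)
    have h3 : (Neg.neg ⁻¹' Set.Iio (0 : ℝ)) = Set.Ioi 0 := by ext; simp
    rw [← h2, h3, ← lintegral_add_left (f := fun t => ENNReal.ofReal (rho t) * F t) (hr.mul hF)]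
    refine lintegral_congr fun t => ?_
    rw [rho_neg, hH, ← mul_add]
  have h4 : Set.Ioi (0 : ℝ) = Set.Ioc 0 1 ∪ Set.Ioi 1 := (Set.Ioc_union_Ioi_eq_Ioi zero_le_one).symm
  have h5 : Set.Ioi (1 : ℝ) = (fun z => z⁻¹) '' Set.Ioo 0 1 := by
    ext t
    constructor
    · intro ht
      exact ⟨t⁻¹, ⟨inv_pos.2 (zero_lt_one.trans ht), inv_lt_one_of_one_lt₀ ht⟩, inv_inv t⟩
    · rintro ⟨z, hz, rfl⟩
      exact (one_lt_inv₀ hz.1).2 hz.2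
  simp only [Pi.mul_apply]
  rw [h1, h4, lintegral_union measurableSet_Ioi (by
      rw [Set.disjoint_left]; intro t ht ht'; exact absurd ht.2 (not_le.2 ht')),
    setLIntegral_congr Ioo_ae_eq_Ioc.symm, h5, lintegral_image_eq_lintegral_abs_deriv_mul
      (f' := fun z => -(z ^ 2)⁻¹) measurableSet_Ioo
      (fun z hz => (hasDerivAt_inv hz.1.ne').hasDerivWithinAt)
      (fun a _ b _ h => inv_injective h), ← lintegral_add_left hHm]
  refine setLIntegral_congr_fun measurableSet_Ioo fun z hz => ?_
  simp only [hH]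
  rw [← mul_assoc (ENNReal.ofReal |_|), ← ENNReal.ofReal_mul (abs_nonneg _), rho_inv hz.1, ← mul_add]

/-- The involution `q ↦ (1 - q) / (1 + q)`. -/
def cayley (q : ℝ) : ℝ := (1 - q) / (1 + q)

lemma cayley_cayley {q : ℝ} (hq : 0 < q) : cayley (cayley q) = q := by
  unfold cayley
  field_simp
  ring

lemma cayley_mem {q : ℝ} (hq : q ∈ Set.Ioo (0 : ℝ) 1) : cayley q ∈ Set.Ioo (0 : ℝ) 1 := by
  have := hq.1
  have := hq.2
  unfold cayley
  constructor
  · apply div_pos <;> linarith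
  · rw [div_lt_one (by linarith)]; linarith

/-- The variable q = (1 - z)/(1 + z) is, for 0 < z < 1, the reciprocal of the argument of the
logarithm in the density, which therefore becomes -log q. -/
lemma rho_cayley {q : ℝ} (hq : q ∈ Set.Ioo (0 : ℝ) 1) :
    |-(2 / (1 + q) ^ 2)| * rho (cayley q) = 2 / Real.pi ^ 2 * (-Real.log q / (1 - q ^ 2)) := by
  have h0 := hq.1
  have h1 : 0 < 1 - q := by linarith [hq.2]
  unfold rho cayley
  have h : |((1 - q) / (1 + q) + 1) / ((1 - q) / (1 + q) - 1)| = q⁻¹ := by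
    rw [show ((1 - q) / (1 + q) + 1) / ((1 - q) / (1 + q) - 1) = -q⁻¹ by
      have h3 : (1 - q) / (1 + q) - 1 = -(2 * q / (1 + q)) := by field_simp; ring
      rw [h3]; field_simp; ring]
    rw [abs_neg, abs_of_pos (by positivity)]
  have h2 : 1 - q ^ 2 = (1 - q) * (1 + q) := by ring
  rw [h, Real.log_inv, abs_neg, abs_of_pos (by positivity), h2]
  field_simp

lemma setLIntegral_rho_cayley (H : ℝ → ENNReal) :
    ∫⁻ z in Set.Ioo (0 : ℝ) 1, ENNReal.ofReal (rho z) * H z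
      = ∫⁻ q in Set.Ioo (0 : ℝ) 1,
        ENNReal.ofReal (2 / Real.pi ^ 2 * (-Real.log q / (1 - q ^ 2))) * H (cayley q) := by
  have himg : Set.Ioo (0 : ℝ) 1 = cayley '' Set.Ioo 0 1 := by
    ext z
    exact ⟨fun hz => ⟨cayley z, cayley_mem hz, cayley_cayley hz.1⟩,
      by rintro ⟨q, hq, rfl⟩; exact cayley_mem hq⟩
  conv_lhs => rw [himg]
  rw [lintegral_image_eq_lintegral_abs_deriv_mul (f' := fun q => -(2 / (1 + q) ^ 2))
    measurableSet_Ioo]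
  · refine setLIntegral_congr_fun measurableSet_Ioo fun q hq => ?_
    rw [← rho_cayley hq, ENNReal.ofReal_mul (abs_nonneg _), mul_assoc]
  · intro q hq
    have h1 : (1 + q) ≠ 0 := by linarith [hq.1]
    refine (((hasDerivAt_id q).const_sub 1).div ((hasDerivAt_id q).const_add 1)
      h1).hasDerivWithinAt.congr_deriv ?_
    simp
    field_simp
    ring
  · intro a ha b hb h
    rw [← cayley_cayley ha.1, h, cayley_cayley hb.1]

/-- The integral of a nonnegative function against `muR`, in the coordinate
`q = (1 - z) / (1 + z)`. -/
theorem integral_muR_cayley {f : ℝ → ℝ} (hf : Measurable f) (hf0 : ∀ t, 0 ≤ f t)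
    (hi : IntegrableOn (fun q => -Real.log q / (1 - q ^ 2) * ((f (cayley q) + f (-cayley q))
      + (f (cayley q)⁻¹ + f (-(cayley q)⁻¹)))) (Set.Ioo 0 1)) :
    Integrable f muR ∧ ∫ t, f t ∂muR = 2 / Real.pi ^ 2 * ∫ q in Set.Ioo (0 : ℝ) 1,
      -Real.log q / (1 - q ^ 2) * ((f (cayley q) + f (-cayley q))
      + (f (cayley q)⁻¹ + f (-(cayley q)⁻¹))) := by
  have hw : ∀ q ∈ Set.Ioo (0 : ℝ) 1, 0 ≤ -Real.log q / (1 - q ^ 2) := fun q hq =>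
    div_nonneg (neg_log_pos_of_mem hq).le (by nlinarith [hq.1, hq.2])
  have hs : ∀ z, 0 ≤ (f z + f (-z)) + (f z⁻¹ + f (-z⁻¹)) := fun z =>
    add_nonneg (add_nonneg (hf0 _) (hf0 _)) (add_nonneg (hf0 _) (hf0 _))
  have key : ∫⁻ t, ENNReal.ofReal (f t) ∂muR = ENNReal.ofReal (2 / Real.pi ^ 2 *
      ∫ q in Set.Ioo (0 : ℝ) 1, -Real.log q / (1 - q ^ 2) * ((f (cayley q) + f (-cayley q))
        + (f (cayley q)⁻¹ + f (-(cayley q)⁻¹)))) := by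
    rw [lintegral_muR_fold hf.ennreal_ofReal, ← integral_const_mul,
      ofReal_integral_eq_lintegral_ofReal (hi.const_mul _)]
    · rw [setLIntegral_rho_cayley]
      refine setLIntegral_congr_fun measurableSet_Ioo fun q hq => ?_
      rw [← ENNReal.ofReal_add (hf0 _) (hf0 _), ← ENNReal.ofReal_add (hf0 _) (hf0 _),
        ← ENNReal.ofReal_add (add_nonneg (hf0 _) (hf0 _)) (add_nonneg (hf0 _) (hf0 _)),
        ← ENNReal.ofReal_mul (mul_nonneg (by positivity) (hw q hq)), mul_assoc]
    · exact (ae_restrict_iff' measurableSet_Ioo).2 (ae_of_all _ fun q hq =>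
        mul_nonneg (by positivity) (mul_nonneg (hw q hq) (hs _)))
  have hval : 0 ≤ 2 / Real.pi ^ 2 * ∫ q in Set.Ioo (0 : ℝ) 1, -Real.log q / (1 - q ^ 2) *
      ((f (cayley q) + f (-cayley q)) + (f (cayley q)⁻¹ + f (-(cayley q)⁻¹))) :=
    mul_nonneg (by positivity) (setIntegral_nonneg measurableSet_Ioo fun q hq =>
      mul_nonneg (hw q hq) (hs _))
  constructor
  · rw [← lintegral_ofReal_ne_top_iff_integrable hf.aestronglyMeasurable (ae_of_all _ hf0), key]
    exact ENNReal.ofReal_ne_top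
  · rw [integral_eq_lintegral_of_nonneg_ae (ae_of_all _ hf0) hf.aestronglyMeasurable, key,
      ENNReal.toReal_ofReal hval]

/-! ### The mean of `log⁺` under `muR` -/

lemma hasSum_rho {z : ℝ} (hz : z ∈ Set.Ioo (0 : ℝ) 1) :
    HasSum (fun k : ℕ => 2 / Real.pi ^ 2 * (1 / (2 * k + 1) * z ^ (2 * k))) (rho z) := by
  have h := (Real.hasSum_log_sub_log_of_abs_lt_one
    (by rw [abs_of_pos hz.1]; exact hz.2 : |z| < 1)).mul_left (1 / (Real.pi ^ 2 * z))
  have hz0 := hz.1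
  have h1 : 0 < 1 - z := by linarith [hz.2]
  have he : rho z = 1 / (Real.pi ^ 2 * z) * (Real.log (1 + z) - Real.log (1 - z)) := by
    rw [rho, ← Real.log_div (by positivity) h1.ne', abs_div, abs_of_pos (by linarith),
      abs_sub_comm, abs_of_pos h1, add_comm z]
  rw [he]
  refine h.congr_fun fun k => ?_
  field_simp
  ring

/-- The mean of `log⁺ |t|` under `muR`. -/
theorem integral_posLog_muR :
    Integrable (fun t : ℝ => Real.posLog |t|) muR ∧
    ∫ t : ℝ, Real.posLog |t| ∂muR = 7 * (riemannZeta 3).re / (2 * Real.pi ^ 2) := by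
  have hm : Measurable fun t : ℝ => Real.posLog |t| := by
    unfold Real.posLog; fun_prop
  have hm0 : ∀ t : ℝ, 0 ≤ Real.posLog |t| := fun t => Real.posLog_nonneg
  have hodd := (hasSum_even_odd (by norm_num) hasSum_zetaThree).2
  have hval : ∀ k : ℕ, ∫ z in Set.Ioo (0 : ℝ) 1,
      4 / Real.pi ^ 2 * (1 / (2 * k + 1)) * ((-Real.log z) ^ 1 * z ^ (2 * k))
      = 4 / Real.pi ^ 2 * (1 / (2 * k + 1) ^ 3) := fun k => by
    rw [integral_const_mul, integral_neg_log_pow_mul_pow]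
    push_cast
    field_simp
    simp
  have hsum := hasSum_integral_of_summable_integral_norm (fun k : ℕ =>
    (integrableOn_neg_log_pow_mul_pow 1 (2 * k)).const_mul (4 / Real.pi ^ 2 * (1 / (2 * k + 1))))
    (by
      refine (hodd.summable.mul_left (4 / Real.pi ^ 2)).congr fun k => ?_
      rw [← hval k]
      refine setIntegral_congr_fun measurableSet_Ioo fun z hz => ?_
      have h1 := (neg_log_pos_of_mem hz).le
      have h2 := hz.1.le
      exact (Real.norm_of_nonneg (by positivity)).symm)
  simp_rw [hval] at hsum
  -- After folding, only ±1/z contribute, each with -log z. The power series of the density gives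
  -- (4/π²) Σ 1/(2k+1)³ = (4/π²)(7/8) ζ(3).
  have hI : ∫ z in Set.Ioo (0 : ℝ) 1, rho z * (-Real.log z + -Real.log z)
      = 7 * (riemannZeta 3).re / (2 * Real.pi ^ 2) := by
    have h1 := (hodd.mul_left (4 / Real.pi ^ 2)).unique hsum
    rw [riemannZeta_three_re]
    calc _ = _ := setIntegral_congr_fun measurableSet_Ioo fun z hz => ?_
      _ = _ := h1.symm
      _ = _ := by field_simp; ring
    rw [← ((hasSum_rho hz).mul_right (-Real.log z + -Real.log z)).tsum_eq]
    congr 1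
    ext k
    ring
  have hz3 : 0 < (riemannZeta 3).re := by
    rw [riemannZeta_three_re]
    exact hasSum_zetaThree.summable.tsum_pos (fun n => by positivity) 1 (by norm_num)
  have hIi : IntegrableOn (fun z => rho z * (-Real.log z + -Real.log z)) (Set.Ioo 0 1) := by
    refine Integrable.of_integral_ne_zero ?_
    rw [hI]
    positivity
  have hrho : ∀ z ∈ Set.Ioo (0 : ℝ) 1, 0 ≤ rho z := fun z hz => by
    refine (hasSum_rho hz).nonneg fun k => ?_
    have := hz.1
    positivity
  have key : ∫⁻ t, ENNReal.ofReal (Real.posLog |t|) ∂muR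
      = ENNReal.ofReal (7 * (riemannZeta 3).re / (2 * Real.pi ^ 2)) := by
    rw [lintegral_muR_fold hm.ennreal_ofReal, ← hI, ofReal_integral_eq_lintegral_ofReal hIi]
    · refine setLIntegral_congr_fun measurableSet_Ioo fun z hz => ?_
      have h1 : Real.posLog |z| = 0 :=
        Real.posLog_eq_zero_iff _ |>.2 (by rw [abs_abs, abs_of_pos hz.1]; exact hz.2.le)
      have h2 : Real.posLog |z⁻¹| = -Real.log z := by
        rw [abs_of_pos (inv_pos.2 hz.1), Real.posLog_eq_log, Real.log_inv]
        rw [abs_of_pos (inv_pos.2 hz.1)]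
        exact ((one_lt_inv₀ hz.1).2 hz.2).le
      have h3 := (neg_log_pos_of_mem hz).le
      simp only [abs_neg]
      rw [h1, h2, ENNReal.ofReal_zero, add_zero, zero_add, ← ENNReal.ofReal_add h3 h3,
        ← ENNReal.ofReal_mul (hrho z hz)]
    · refine (ae_restrict_iff' measurableSet_Ioo).2 (ae_of_all _ fun z hz => ?_)
      have h3 := (neg_log_pos_of_mem hz).le
      exact mul_nonneg (hrho z hz) (by linarith)
  constructor
  · rw [← lintegral_ofReal_ne_top_iff_integrable hm.aestronglyMeasurable (ae_of_all _ hm0), key]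
    exact ENNReal.ofReal_ne_top
  · rw [integral_eq_lintegral_of_nonneg_ae (ae_of_all _ hm0) hm.aestronglyMeasurable, key,
      ENNReal.toReal_ofReal (by positivity)]

/-! ### The energy of measures on the strip -/

/-- The coordinates of stereographic projection. -/
def sphere : Fin 3 → ℂ → ℝ :=
  ![fun z => 2 * z.re / (1 + ‖z‖ ^ 2), fun z => 2 * z.im / (1 + ‖z‖ ^ 2),
    fun z => (‖z‖ ^ 2 - 1) / (1 + ‖z‖ ^ 2)]

lemma norm_sq_eq (z : ℂ) : ‖z‖ ^ 2 = z.re ^ 2 + z.im ^ 2 := by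
  rw [← Complex.normSq_eq_norm_sq, Complex.normSq_apply]; ring

lemma measurable_sphere (i : Fin 3) : Measurable (sphere i) := by
  fin_cases i
  · exact (by fun_prop : Measurable fun z : ℂ => 2 * z.re / (1 + ‖z‖ ^ 2))
  · exact (by fun_prop : Measurable fun z : ℂ => 2 * z.im / (1 + ‖z‖ ^ 2))
  · exact (by fun_prop : Measurable fun z : ℂ => (‖z‖ ^ 2 - 1) / (1 + ‖z‖ ^ 2))

lemma sum_sphere_sq (z : ℂ) : ∑ i, sphere i z ^ 2 = 1 := by
  have h : 0 < 1 + (z.re ^ 2 + z.im ^ 2) := by positivity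
  simp only [sphere, Fin.sum_univ_three, Matrix.cons_val_zero, Matrix.cons_val_one,
    Matrix.cons_val, norm_sq_eq]
  field_simp
  ring

lemma one_sub_gram_sphere (p : ℂ × ℂ) :
    1 - gram sphere p = 2 * ‖p.1 - p.2‖ ^ 2 / ((1 + ‖p.1‖ ^ 2) * (1 + ‖p.2‖ ^ 2)) := by
  have h1 : 0 < 1 + (p.1.re ^ 2 + p.1.im ^ 2) := by positivity
  have h2 : 0 < 1 + (p.2.re ^ 2 + p.2.im ^ 2) := by positivity
  simp only [gram, sphere, Fin.sum_univ_three, Matrix.cons_val_zero, Matrix.cons_val_one,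
    Matrix.cons_val, norm_sq_eq, Complex.sub_re, Complex.sub_im]
  field_simp
  ring

lemma gram_sphere_ne_one {p : ℂ × ℂ} (hp : p.1 ≠ p.2) : gram sphere p ≠ 1 := by
  intro h
  have h1 := one_sub_gram_sphere p
  have h2 : 0 < ‖p.1 - p.2‖ := norm_pos_iff.2 (sub_ne_zero.2 hp)
  rw [h, sub_self] at h1
  have : 0 < 2 * ‖p.1 - p.2‖ ^ 2 / ((1 + ‖p.1‖ ^ 2) * (1 + ‖p.2‖ ^ 2)) := by positivity
  linarith

lemma log_one_sub_gram_sphere {p : ℂ × ℂ} (hp : p.1 ≠ p.2) :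
    Real.log (1 - gram sphere p) = Real.log 2 - 2 * chord p.1 p.2 := by
  have h2 : 0 < ‖p.1 - p.2‖ := norm_pos_iff.2 (sub_ne_zero.2 hp)
  rw [one_sub_gram_sphere, chord, Real.log_div (by positivity) (by positivity),
    Real.log_mul (by positivity) (by positivity), Real.log_mul (by positivity) (by positivity),
    Real.log_pow]
  push_cast
  ring

/-- Two measures of finite chordal energy satisfy the parallelogram-type inequality expressing
positivity of the chordal energy of their difference. -/
lemma two_mul_chord_le (μ ν : Measure ℂ) [IsProbabilityMeasure μ] [IsProbabilityMeasure ν]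
    (hμμ : ∀ᵐ p ∂(μ.prod μ), p.1 ≠ p.2) (hνν : ∀ᵐ p ∂(ν.prod ν), p.1 ≠ p.2)
    (hμν : ∀ᵐ p ∂(μ.prod ν), p.1 ≠ p.2)
    (iμμ : Integrable (fun p => chord p.1 p.2) (μ.prod μ))
    (iνν : Integrable (fun p => chord p.1 p.2) (ν.prod ν))
    (iμν : Integrable (fun p => chord p.1 p.2) (μ.prod ν)) :
    2 * ∫ p, chord p.1 p.2 ∂(μ.prod ν)
      ≤ ∫ p, chord p.1 p.2 ∂(μ.prod μ) + ∫ p, chord p.1 p.2 ∂(ν.prod ν) := by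
  have hae : ∀ m : Measure (ℂ × ℂ), (∀ᵐ p ∂m, p.1 ≠ p.2) →
      (fun p => Real.log (1 - gram sphere p)) =ᵐ[m] fun p => Real.log 2 - 2 * chord p.1 p.2 :=
    fun m hm => hm.mono fun p hp => log_one_sub_gram_sphere hp
  have hkey : ∀ (m : Measure (ℂ × ℂ)) [IsProbabilityMeasure m], (∀ᵐ p ∂m, p.1 ≠ p.2) →
      Integrable (fun p => chord p.1 p.2) m →
      Integrable (fun p => Real.log (1 - gram sphere p)) m ∧
      ∫ p, -Real.log (1 - gram sphere p) ∂m = 2 * ∫ p, chord p.1 p.2 ∂m - Real.log 2 := by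
    intro m _ hm hi
    have h2 := hi.const_mul 2
    refine ⟨((integrable_const _).sub h2).congr (hae m hm).symm, ?_⟩
    rw [integral_neg, integral_congr_ae (hae m hm), integral_sub (integrable_const _) h2,
      integral_const_mul]
    simp
  have h := diffForm_neg_log_one_sub_nonneg measurable_sphere sum_sphere_sq μ ν
    (hμμ.mono fun _ => gram_sphere_ne_one) (hνν.mono fun _ => gram_sphere_ne_one)
    (hμν.mono fun _ => gram_sphere_ne_one) (hkey _ hμμ iμμ).1 (hkey _ hνν iνν).1 (hkey _ hμν iμν).1
  rw [diffForm, (hkey _ hμμ iμμ).2, (hkey _ hνν iνν).2, (hkey _ hμν iμν).2] at h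
  linarith

/-- Gives a bound, uniform in x, for the chordal potential of `muR`, hence finite mutual energy with
every probability measure. It rests on (1 + |x|²) sin² θ ≤ 2M², M being the larger distance from x
to e^{±iθ}, and on the integrability of log sin θ. -/
lemma exists_le_potential : ∃ K, ∀ x, 1 / 2 * Real.log (1 + ‖x‖ ^ 2) - K ≤ potential x := by
  have hls : IntegrableOn (fun θ => Real.log (Real.sin θ)) (Set.Ioo 0 Real.pi) :=
    (intervalIntegrable_iff_integrableOn_Ioo_of_le Real.pi_pos.le).1 intervalIntegrable_log_sin
  refine ⟨1 / 2 * Real.log 2 - 1 / Real.pi * ∫ θ in Set.Ioo 0 Real.pi, Real.log (Real.sin θ),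
    fun x => ?_⟩
  have hc : IntegrableOn (fun _ : ℝ => 1 / 2 * Real.log (1 + ‖x‖ ^ 2) - 1 / 2 * Real.log 2)
    (Set.Ioo 0 Real.pi) := integrable_const _
  have hle : ∫ θ in Set.Ioo 0 Real.pi, (1 / 2 * Real.log (1 + ‖x‖ ^ 2) - 1 / 2 * Real.log 2
      + Real.log (Real.sin θ)) ≤ ∫ θ in Set.Ioo 0 Real.pi, logMax x θ := by
    refine setIntegral_mono_on (hc.add hls) (integrableOn_logMax x) measurableSet_Ioo
      fun θ hθ => ?_
    have hs := Real.sin_pos_of_pos_of_lt_pi hθ.1 hθ.2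
    set M := max ‖x - unitPt (-θ)‖ ‖x - unitPt θ‖ with hM
    have h1 : ‖x - unitPt (-θ)‖ ≤ M := le_max_left _ _
    have h2 : ‖x - unitPt θ‖ ≤ M := le_max_right _ _
    have h1' := pow_le_pow_left₀ (norm_nonneg _) h1 2
    have h2' := pow_le_pow_left₀ (norm_nonneg _) h2 2
    have hM0 : 0 ≤ M := (norm_nonneg _).trans h1
    rw [norm_sq_eq] at h1' h2'
    simp only [Complex.sub_re, Complex.sub_im, unitPt_re, unitPt_im, Real.cos_neg,
      Real.sin_neg] at h1' h2'
    have hsc := Real.sin_sq_add_cos_sq θ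
    have h3 : (1 + ‖x‖ ^ 2) * Real.sin θ ^ 2 ≤ 2 * M ^ 2 := by
      rw [norm_sq_eq]
      nlinarith [sq_nonneg (x.re - Real.cos θ), sq_nonneg (x.im), sq_nonneg (x.re * Real.cos θ - 1),
        sq_nonneg (x.im * Real.cos θ), sq_nonneg (Real.sin θ)]
    have hM1 : 0 < M := by
      rcases hM0.lt_or_eq with h | h
      · exact h
      · rw [← h] at h3
        have : 0 < (1 + ‖x‖ ^ 2) * Real.sin θ ^ 2 := by positivity
        linarith
    have h4 := Real.log_le_log (by positivity) h3
    rw [Real.log_mul (by positivity) (by positivity), Real.log_mul (by positivity) (by positivity),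
      Real.log_pow, Real.log_pow] at h4
    push_cast at h4
    rw [logMax, ← hM]
    linarith
  have e := integral_add hc hls
  rw [e] at hle
  simp only [integral_const, MeasurableSet.univ, measureReal_restrict_apply, Set.univ_inter,
    Real.volume_real_Ioo_of_le Real.pi_pos.le, sub_zero, smul_eq_mul] at hle
  rw [potential]
  have h5 := mul_le_mul_of_nonneg_left hle (by positivity : 0 ≤ 1 / Real.pi)
  rw [mul_add, ← mul_assoc, one_div_mul_cancel Real.pi_pos.ne', one_mul] at h5
  linarith

/-- `muR` as a measure on the complex plane. -/
def muC : Measure ℂ := muR.map ((↑) : ℝ → ℂ)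

instance isProbabilityMeasure_muC : IsProbabilityMeasure muC :=
  Measure.isProbabilityMeasure_map Complex.measurable_ofReal.aemeasurable

lemma muC_singleton (z : ℂ) : muC {z} = 0 := by
  rw [muC, Measure.map_apply Complex.measurable_ofReal (measurableSet_singleton z)]
  refine withDensity_absolutelyContinuous _ _ ?_
  refine Set.Subsingleton.measure_zero ?_ _
  intro a ha b hb
  simp only [Set.mem_preimage, Set.mem_singleton_iff] at ha hb
  exact_mod_cast ha.trans hb.symm

/-- Since `muC` has no atoms, every vertical slice of the diagonal is null. -/
lemma ae_prod_muC_ne (μ : Measure ℂ) : ∀ᵐ p ∂(μ.prod muC), p.1 ≠ p.2 := by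
  have hD : MeasurableSet {p : ℂ × ℂ | ¬ p.1 ≠ p.2} := by
    simpa using measurableSet_eq_fun measurable_fst measurable_snd
  rw [ae_iff, Measure.measure_prod_null hD]
  refine ae_of_all _ fun x => ?_
  have : (Prod.mk x ⁻¹' {p : ℂ × ℂ | ¬ p.1 ≠ p.2}) = {x} := by
    ext y; simp [eq_comm]
  beta_reduce
  rw [this]
  exact muC_singleton x

lemma measurable_chord_right (x : ℂ) : Measurable fun y => chord x y := by
  unfold chord; fun_prop

lemma integrable_chord_muC (x : ℂ) : Integrable (fun y => chord x y) muC := by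
  rw [muC, integrable_map_measure (measurable_chord_right x).aestronglyMeasurable
    Complex.measurable_ofReal.aemeasurable]
  exact (integral_chord_muR x).1

lemma integral_chord_muC (x : ℂ) :
    ∫ y, chord x y ∂muC = meanLog + 1 / 2 * Real.log (1 + ‖x‖ ^ 2) - potential x := by
  rw [muC, integral_map Complex.measurable_ofReal.aemeasurable
    (measurable_chord_right x).aestronglyMeasurable, integral_chord_muR_eq]

lemma integrable_chord_prod_muC (μ : Measure ℂ) [IsProbabilityMeasure μ] :
    Integrable (fun p => chord p.1 p.2) (μ.prod muC) := by
  rw [integrable_prod_iff measurable_chord.aestronglyMeasurable]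
  refine ⟨ae_of_all _ fun x => integrable_chord_muC x, ?_⟩
  obtain ⟨K, hK⟩ := exists_le_potential
  have hn : ∀ x, ∫ y, ‖chord x y‖ ∂muC = ∫ y, chord x y ∂muC := fun x =>
    integral_congr_ae (ae_of_all _ fun y => Real.norm_of_nonneg (chord_nonneg x y))
  simp only [hn]
  refine Integrable.of_bound
    (measurable_chord.stronglyMeasurable.integral_prod_right').aestronglyMeasurable (meanLog + K)
    (ae_of_all _ fun x => ?_)
  rw [Real.norm_of_nonneg (integral_nonneg fun y => chord_nonneg x y), integral_chord_muC]
  linarith [hK x]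

/-- The bounded correction between the logarithmic and the chordal kernels. -/
def corr (z : ℂ) : ℝ := Real.posLog ‖z‖ - 1 / 2 * Real.log (1 + ‖z‖ ^ 2)

lemma measurable_corr : Measurable corr := by
  unfold corr Real.posLog; fun_prop

lemma abs_corr_le (z : ℂ) : |corr z| ≤ Real.log 2 := by
  have hl := Real.log_nonneg (by norm_num : (1 : ℝ) ≤ 2)
  have h0 := norm_nonneg z
  have hmax : 0 < max 1 ‖z‖ := lt_max_of_lt_left one_pos
  have h1 : Real.log (max 1 ‖z‖ ^ 2) ≤ Real.log (1 + ‖z‖ ^ 2) := by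
    refine Real.log_le_log (by positivity) ?_
    rcases max_cases 1 ‖z‖ with h | h <;> rw [h.1] <;> nlinarith
  have h2 : Real.log (1 + ‖z‖ ^ 2) ≤ Real.log (2 * max 1 ‖z‖ ^ 2) := by
    refine Real.log_le_log (by positivity) ?_
    rcases max_cases 1 ‖z‖ with h | h <;> rw [h.1] <;> nlinarith
  rw [Real.log_mul (by norm_num) (by positivity), Real.log_pow] at h2
  rw [Real.log_pow] at h1
  push_cast at h1 h2
  rw [corr, Real.posLog_eq_log_max_one h0, abs_le]
  constructor <;> linarith

lemma integrable_corr (μ : Measure ℂ) [IsFiniteMeasure μ] : Integrable corr μ :=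
  Integrable.of_bound measurable_corr.aestronglyMeasurable _ (ae_of_all _ abs_corr_le)

/-- On the support the logarithmic potential is log⁺, whose mean is 7ζ(3)/(2π²); the two terms ½
log(1 + |·|²) contribute `meanLog` each. -/
lemma integral_chord_muC_muC : ∫ p, chord p.1 p.2 ∂(muC.prod muC)
    = 2 * meanLog - 7 * (riemannZeta 3).re / (2 * Real.pi ^ 2) := by
  have h2 : Measurable fun x : ℂ => meanLog + 1 / 2 * Real.log (1 + ‖x‖ ^ 2) - potential x := by
    have h := (measurable_chord.stronglyMeasurable.integral_prod_right' (ν := muC)).measurable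
    simpa only [integral_chord_muC] using h
  rw [integral_prod _ (integrable_chord_prod_muC muC)]
  simp only [integral_chord_muC]
  rw [muC, integral_map Complex.measurable_ofReal.aemeasurable h2.aestronglyMeasurable]
  simp_rw [potential_ofReal]
  have hi := integral_log_one_add_sq_muR.1
  have e1 := integral_sub ((integrable_const meanLog).add hi) integral_posLog_muR.1
  have e2 := integral_add (integrable_const (μ := muR) meanLog) hi
  simp only [Pi.add_apply] at e1
  rw [e1, e2, integral_posLog_muR.2, ← meanLog]
  simp
  ring

/-- The lower bound for the logarithmic energy of a measure on a strip. -/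
theorem le_integral_chord_add_corr (μ : Measure ℂ) [IsProbabilityMeasure μ] {ε : ℝ}
    (hε : ∀ᵐ z ∂μ, |z.im| ≤ ε) (hμμ : ∀ᵐ p ∂(μ.prod μ), p.1 ≠ p.2)
    (hi : Integrable (fun p => chord p.1 p.2) (μ.prod μ)) :
    7 * (riemannZeta 3).re / (2 * Real.pi ^ 2) - 2 * Real.sqrt ε
      ≤ ∫ p, (chord p.1 p.2 + corr p.1 + corr p.2) ∂(μ.prod μ) := by
  -- Positivity of the chordal energy of μ - `muC`; the mutual term and the self-energy of `muC` are
  -- known, up to √ε.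
  have h1 := two_mul_chord_le μ muC hμμ (ae_prod_muC_ne muC) (ae_prod_muC_ne μ) hi
    (integrable_chord_prod_muC muC) (integrable_chord_prod_muC μ)
  have hc1 : Integrable (fun p : ℂ × ℂ => corr p.1) (μ.prod μ) :=
    Integrable.of_bound (measurable_corr.comp measurable_fst).aestronglyMeasurable _
      (ae_of_all _ fun p => abs_corr_le p.1)
  have hc2 : Integrable (fun p : ℂ × ℂ => corr p.2) (μ.prod μ) :=
    Integrable.of_bound (measurable_corr.comp measurable_snd).aestronglyMeasurable _
      (ae_of_all _ fun p => abs_corr_le p.2)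
  have e1 := integral_add (hi.add hc1) hc2
  have e2 := integral_add hi hc1
  have e3 : ∫ p, corr p.1 ∂(μ.prod μ) = ∫ z, corr z ∂μ := by
    rw [integral_prod _ hc1]; simp
  have e4 : ∫ p, corr p.2 ∂(μ.prod μ) = ∫ z, corr z ∂μ := by
    rw [integral_prod _ hc2]; simp
  simp only [Pi.add_apply] at e1
  rw [e1, e2, e3, e4]
  have hi' := (integrable_chord_prod_muC μ).integral_prod_left
  -- The chordal potential of `muC` at z equals `meanLog - corr z` minus the excess of `potential z`
  -- over log⁺|z|, which is at most √ε on the strip. In the final combination `meanLog` cancels and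
  -- the two `corr` integrals are absorbed.
  have h2 : ∫ z, (meanLog - corr z - Real.sqrt ε) ∂μ ≤ ∫ p, chord p.1 p.2 ∂(μ.prod muC) := by
    rw [integral_prod _ (integrable_chord_prod_muC μ)]
    refine integral_mono_ae (((integrable_const _).sub (integrable_corr μ)).sub
      (integrable_const _)) hi' ?_
    filter_upwards [hε] with z hz
    rw [integral_chord_muC, corr]
    linarith [potential_le hz]
  have e5 := integral_sub ((integrable_const (μ := μ) meanLog).sub (integrable_corr μ))
    (integrable_const (Real.sqrt ε))
  have e6 := integral_sub (integrable_const (μ := μ) meanLog) (integrable_corr μ)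
  simp only [Pi.sub_apply] at e5
  rw [e5, e6] at h2
  simp only [integral_const, probReal_univ, one_smul] at h2
  rw [integral_chord_muC_muC] at h1
  linarith

/-! ### Passage to the projective line -/

lemma delta_coe (z w : ℂ) :
    delta (z : P1) (w : P1) = ‖z - w‖ / (max 1 ‖z‖ * max 1 ‖w‖) := by
  have h : delta (z : P1) (w : P1) = deltaHom ![z, 1] ![w, 1] := rfl
  rw [h, deltaHom]
  simp [max_comm]

lemma kernel_coe {z w : ℂ} (h : z ≠ w) :
    kernel (z : P1) (w : P1) = ((chord z w + corr z + corr w : ℝ) : EReal) := by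
  have h0 : 0 < ‖z - w‖ := norm_pos_iff.2 (sub_ne_zero.2 h)
  have hz : 0 < max 1 ‖z‖ := lt_max_of_lt_left one_pos
  have hw : 0 < max 1 ‖w‖ := lt_max_of_lt_left one_pos
  have hd : 0 < delta (z : P1) (w : P1) := by rw [delta_coe]; positivity
  have he : Real.log (delta (z : P1) (w : P1)) = -(chord z w + corr z + corr w) := by
    rw [delta_coe, Real.log_div (by positivity) (by positivity),
      Real.log_mul (by positivity) (by positivity), chord, corr, corr,
      Real.posLog_eq_log_max_one (norm_nonneg z), Real.posLog_eq_log_max_one (norm_nonneg w)]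
    ring
  rw [kernel, ENNReal.log_ofReal_of_pos hd, he, EReal.coe_neg, neg_neg]

lemma kernel_self (x : P1) : kernel x x = ⊤ := by
  simp [kernel, delta, deltaHom]

/-- A measure whose energy is finite gives no mass to the diagonal. -/
lemma ae_ne_of_lintegral_ne_top {μ : Measure ℂ}
    (h : ∫⁻ p, (kernel (p.1 : P1) (p.2 : P1)).toENNReal ∂(μ.prod μ) ≠ ⊤) :
    ∀ᵐ p ∂(μ.prod μ), p.1 ≠ p.2 := by
  have hD : MeasurableSet {p : ℂ × ℂ | p.1 = p.2} :=
    measurableSet_eq_fun measurable_fst measurable_snd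
  rw [ae_iff]
  simp only [not_not]
  by_contra hne
  refine h (top_le_iff.1 ?_)
  calc (⊤ : ENNReal) = ⊤ * (μ.prod μ) {p : ℂ × ℂ | p.1 = p.2} := (ENNReal.top_mul hne).symm
    _ = ∫⁻ p in {p : ℂ × ℂ | p.1 = p.2}, ⊤ ∂(μ.prod μ) := (setLIntegral_const _ _).symm
    _ = ∫⁻ p in {p : ℂ × ℂ | p.1 = p.2},
        (kernel (p.1 : P1) (p.2 : P1)).toENNReal ∂(μ.prod μ) := by
          refine setLIntegral_congr_fun hD fun p hp => ?_
          have hp' : p.1 = p.2 := hp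
          rw [hp', kernel_self]
          simp
    _ ≤ _ := setLIntegral_le_lintegral _ _

lemma measurableEmbedding_coe : MeasurableEmbedding ((↑) : ℂ → P1) :=
  OnePoint.isOpenEmbedding_coe.measurableEmbedding

/-- The point (∞, ∞) lies on the diagonal, where the kernel is `⊤`, so an atom at ∞ would make the
integral infinite. -/
lemma measure_infty_eq_zero {μ : Measure P1} [IsFiniteMeasure μ]
    (h : ∫⁻ p, (kernel p.1 p.2).toENNReal ∂(μ.prod μ) ≠ ⊤) : μ {∞} = 0 := by
  by_contra hne
  refine h (top_le_iff.1 ?_)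
  have hne2 : (μ.prod μ) ({∞} ×ˢ {∞}) ≠ 0 := by
    rw [Measure.prod_prod]; exact mul_ne_zero hne hne
  calc (⊤ : ENNReal) = ⊤ * (μ.prod μ) ({∞} ×ˢ {∞}) := (ENNReal.top_mul hne2).symm
    _ = ∫⁻ p in ({∞} ×ˢ {∞} : Set (P1 × P1)), ⊤ ∂(μ.prod μ) := (setLIntegral_const _ _).symm
    _ = ∫⁻ p in ({∞} ×ˢ {∞} : Set (P1 × P1)), (kernel p.1 p.2).toENNReal ∂(μ.prod μ) := by
          refine setLIntegral_congr_fun ((measurableSet_singleton _).prod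
            (measurableSet_singleton _)) fun p hp => ?_
          obtain ⟨h1, h2⟩ := hp
          have h1' : p.1 = ∞ := h1
          have h2' : p.2 = ∞ := h2
          rw [h1', h2', kernel_self]
          simp
    _ ≤ _ := setLIntegral_le_lintegral _ _

lemma exists_map_coe_eq {μ : Measure P1} [IsProbabilityMeasure μ] (h : μ {∞} = 0) :
    ∃ m : Measure ℂ, IsProbabilityMeasure m ∧ m.map ((↑) : ℂ → P1) = μ := by
  have hr : (Set.range ((↑) : ℂ → P1))ᶜ = {∞} := OnePoint.compl_range_coe
  have hmap : (μ.comap ((↑) : ℂ → P1)).map ((↑) : ℂ → P1) = μ := by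
    rw [measurableEmbedding_coe.map_comap]
    refine Measure.restrict_eq_self_of_ae_mem ?_
    rw [ae_iff]
    have : {a | a ∉ Set.range ((↑) : ℂ → P1)} = {∞} := hr
    rw [this, h]
  refine ⟨μ.comap ((↑) : ℂ → P1), ⟨?_⟩, hmap⟩
  have h1 : (μ.comap ((↑) : ℂ → P1)).map ((↑) : ℂ → P1) Set.univ = 1 := by
    rw [hmap]; exact measure_univ
  rwa [Measure.map_apply measurableEmbedding_coe.measurable MeasurableSet.univ,
    Set.preimage_univ] at h1

lemma ofReal_toENNReal_coe (x : ℝ) : (x : EReal).toENNReal = ENNReal.ofReal x := by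
  simp [EReal.toENNReal]

lemma delta_le_two (x y : P1) : delta x y ≤ 2 := by
  unfold delta deltaHom
  set v := homCoords x
  set w := homCoords y
  refine div_le_of_le_mul₀ (by positivity) (by norm_num) ((norm_sub_le _ _).trans ?_)
  rw [norm_mul, norm_mul]
  have h1 : ‖v 0‖ * ‖w 1‖ ≤ max ‖v 0‖ ‖v 1‖ * max ‖w 0‖ ‖w 1‖ := by
    gcongr
    · exact le_max_left _ _
    · exact le_max_right _ _
  have h2 : ‖w 0‖ * ‖v 1‖ ≤ max ‖v 0‖ ‖v 1‖ * max ‖w 0‖ ‖w 1‖ := by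
    rw [mul_comm]
    gcongr
    · exact le_max_right _ _
    · exact le_max_left _ _
  linarith

lemma toENNReal_neg_kernel_le (x y : P1) :
    (-kernel x y).toENNReal ≤ ENNReal.ofReal (Real.log 2) := by
  rw [kernel, neg_neg, ← ofReal_toENNReal_coe (Real.log 2), ← ENNReal.log_ofReal_of_pos two_pos]
  exact EReal.toENNReal_le_toENNReal
    (ENNReal.log_monotone (ENNReal.ofReal_le_ofReal (delta_le_two x y)))

lemma lintegral_neg_kernel_ne_top (μ : Measure P1) [IsProbabilityMeasure μ] :
    ∫⁻ p, (-kernel p.1 p.2).toENNReal ∂(μ.prod μ) ≠ ⊤ := by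
  have h : ∫⁻ p, (-kernel p.1 p.2).toENNReal ∂(μ.prod μ)
      ≤ ∫⁻ _, ENNReal.ofReal (Real.log 2) ∂(μ.prod μ) :=
    lintegral_mono fun p => toENNReal_neg_kernel_le p.1 p.2
  rw [lintegral_const, measure_univ, mul_one] at h
  exact ne_top_of_le_ne_top ENNReal.ofReal_ne_top h

/-- The energy of a probability measure on the strip of width `ε`. -/
theorem le_energy {ε : ℝ} (μ : Measure P1) [IsProbabilityMeasure μ] (hμ : μ (strip ε)ᶜ = 0) :
    ((7 * (riemannZeta 3).re / (2 * Real.pi ^ 2) - 2 * Real.sqrt ε : ℝ) : EReal) ≤ energy μ := by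
  -- Because δ ≤ 2 the negative part is finite, so an infinite positive part makes the `EReal`
  -- difference equal to `⊤`.
  by_cases htop : ∫⁻ p, (kernel p.1 p.2).toENNReal ∂(μ.prod μ) = ⊤
  · rw [energy, htop, ← EReal.coe_ennreal_toReal (lintegral_neg_kernel_ne_top μ),
      EReal.coe_ennreal_top, EReal.top_sub_coe]
    exact le_top
  obtain ⟨m, hm, rfl⟩ := exists_map_coe_eq (measure_infty_eq_zero htop)
  have hemb : MeasurableEmbedding (Prod.map ((↑) : ℂ → P1) ((↑) : ℂ → P1)) :=
    measurableEmbedding_coe.prodMap measurableEmbedding_coe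
  have hprod : (m.map ((↑) : ℂ → P1)).prod (m.map ((↑) : ℂ → P1))
      = (m.prod m).map (Prod.map ((↑) : ℂ → P1) ((↑) : ℂ → P1)) :=
    Measure.map_prod_map _ _ measurableEmbedding_coe.measurable measurableEmbedding_coe.measurable
  rw [hprod, hemb.lintegral_map] at htop
  have hae := ae_ne_of_lintegral_ne_top htop
  have hstrip : ∀ᵐ z ∂m, |z.im| ≤ ε := by
    have h1 := measurableEmbedding_coe.ae_map_iff.1 (mem_ae_iff.2 hμ)
    filter_upwards [h1] with z hz
    rcases hz with ⟨w, hw, hwz⟩ | hz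
    · rwa [← OnePoint.coe_injective hwz]
    · exact absurd hz (OnePoint.coe_ne_infty z)
  set κ : ℂ × ℂ → ℝ := fun p => chord p.1 p.2 + corr p.1 + corr p.2 with hκ
  have hκm : Measurable κ := (measurable_chord.add (measurable_corr.comp measurable_fst)).add
    (measurable_corr.comp measurable_snd)
  have hpos : ∫⁻ p, (kernel (p.1 : P1) (p.2 : P1)).toENNReal ∂(m.prod m)
      = ∫⁻ p, ENNReal.ofReal (κ p) ∂(m.prod m) := by
    refine lintegral_congr_ae ?_
    filter_upwards [hae] with p hp
    rw [kernel_coe hp, ofReal_toENNReal_coe]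
  have hneg : ∫⁻ p, (-kernel (p.1 : P1) (p.2 : P1)).toENNReal ∂(m.prod m)
      = ∫⁻ p, ENNReal.ofReal (-κ p) ∂(m.prod m) := by
    refine lintegral_congr_ae ?_
    filter_upwards [hae] with p hp
    rw [kernel_coe hp, ← EReal.coe_neg, ofReal_toENNReal_coe]
  have hκle : ∀ p, -κ p ≤ 2 * Real.log 2 := fun p => by
    have h1 := (abs_le.1 (abs_corr_le p.1)).1
    have h2 := (abs_le.1 (abs_corr_le p.2)).1
    have h3 := chord_nonneg p.1 p.2
    simp only [hκ]
    linarith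
  have hnegtop : ∫⁻ p, ENNReal.ofReal (-κ p) ∂(m.prod m) ≠ ⊤ := by
    refine ((lintegral_mono fun p => ENNReal.ofReal_le_ofReal (hκle p)).trans_lt ?_).ne
    rw [lintegral_const, measure_univ, mul_one]
    exact ENNReal.ofReal_lt_top
  have hκi : Integrable κ (m.prod m) := by
    refine ⟨hκm.aestronglyMeasurable, ?_⟩
    rw [hasFiniteIntegral_iff_norm]
    have : ∀ p, ENNReal.ofReal ‖κ p‖ = ENNReal.ofReal (κ p) + ENNReal.ofReal (-κ p) := fun p => by
      rcases le_total 0 (κ p) with h | h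
      · rw [Real.norm_of_nonneg h, ENNReal.ofReal_of_nonpos (neg_nonpos.2 h), add_zero]
      · rw [Real.norm_of_nonpos h, ENNReal.ofReal_of_nonpos h, zero_add]
    simp_rw [this]
    rw [lintegral_add_left hκm.ennreal_ofReal]
    refine ENNReal.add_lt_top.2 ⟨?_, hnegtop.lt_top⟩
    rw [← hpos]
    exact lt_top_iff_ne_top.2 htop
  have hc : Integrable (fun p : ℂ × ℂ => chord p.1 p.2) (m.prod m) := by
    have hc1 : Integrable (fun p : ℂ × ℂ => corr p.1) (m.prod m) :=
      Integrable.of_bound (measurable_corr.comp measurable_fst).aestronglyMeasurable _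
        (ae_of_all _ fun p => abs_corr_le p.1)
    have hc2 : Integrable (fun p : ℂ × ℂ => corr p.2) (m.prod m) :=
      Integrable.of_bound (measurable_corr.comp measurable_snd).aestronglyMeasurable _
        (ae_of_all _ fun p => abs_corr_le p.2)
    refine ((hκi.sub hc1).sub hc2).congr (ae_of_all _ fun p => ?_)
    simp only [hκ, Pi.sub_apply]
    ring
  have hmain := le_integral_chord_add_corr m hstrip hae hc
  have hE : energy (m.map ((↑) : ℂ → P1)) = ((∫ p, κ p ∂(m.prod m) : ℝ) : EReal) := by
    rw [energy, hprod, hemb.lintegral_map, hemb.lintegral_map,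
      integral_eq_lintegral_pos_part_sub_lintegral_neg_part hκi, EReal.coe_sub]
    have hpt : ∫⁻ p, ENNReal.ofReal (κ p) ∂(m.prod m) ≠ ⊤ := hpos ▸ htop
    rw [EReal.coe_ennreal_toReal hpt, EReal.coe_ennreal_toReal hnegtop, ← hpos, ← hneg]
    rfl
  rw [hE]
  exact_mod_cast hmain

/-! ### Polynomials with rational coefficients as lists -/

/-- The value at `x` of the polynomial with the given coefficients, constant term first. -/
def ev : List ℚ → ℝ → ℝ
  | [], _ => 0
  | a :: p, x => a + x * ev p x

/-- Sum of polynomials. -/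
def padd : List ℚ → List ℚ → List ℚ
  | [], q => q
  | p, [] => p
  | a :: p, b :: q => (a + b) :: padd p q

/-- Multiplication of a polynomial by a constant. -/
def psmul (c : ℚ) : List ℚ → List ℚ
  | [] => []
  | a :: p => (c * a) :: psmul c p

/-- Product of polynomials. -/
def pmul : List ℚ → List ℚ → List ℚ
  | [], _ => []
  | a :: p, q => padd (psmul a q) (0 :: pmul p q)

/-- Derivative of a polynomial. -/
def pder : List ℚ → List ℚ
  | [] => []
  | _ :: p => padd p (0 :: pder p)

/-- Whether all coefficients vanish. -/
def pzero : List ℚ → Bool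
  | [] => true
  | a :: p => decide (a = 0) && pzero p

/-- Sum of the absolute values of the coefficients. -/
def absSum : List ℚ → ℚ
  | [] => 0
  | a :: p => |a| + absSum p

/-- The combination of the shifted Chebyshev polynomials `T_k (2 x - 1)`, `k ≥ n`, with given
coefficients, where `t` and `u` are the polynomials for `k = n` and `k = n + 1`. -/
def chebComb : List ℚ → List ℚ → List ℚ → List ℚ
  | [], _, _ => []
  | c :: r, t, u => padd (psmul c t) (chebComb r u (padd (pmul [-2, 4] u) (psmul (-1) t)))

lemma ev_padd (p q : List ℚ) (x : ℝ) : ev (padd p q) x = ev p x + ev q x := by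
  induction p generalizing q with
  | nil => simp [padd, ev]
  | cons a p ih =>
    cases q with
    | nil => simp [padd, ev]
    | cons b q => simp only [padd, ev, ih]; push_cast; ring

lemma ev_psmul (c : ℚ) (p : List ℚ) (x : ℝ) : ev (psmul c p) x = c * ev p x := by
  induction p with
  | nil => simp [psmul, ev]
  | cons a p ih => simp only [psmul, ev, ih]; push_cast; ring

lemma ev_pmul (p q : List ℚ) (x : ℝ) : ev (pmul p q) x = ev p x * ev q x := by
  induction p with
  | nil => simp [pmul, ev]
  | cons a p ih => simp only [pmul, ev, ev_padd, ev_psmul, ih]; push_cast; ring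

lemma hasDerivAt_ev (p : List ℚ) (x : ℝ) : HasDerivAt (ev p) (ev (pder p) x) x := by
  induction p with
  | nil => simpa [pder, ev] using! hasDerivAt_const x (0 : ℝ)
  | cons a p ih =>
    have h := ((hasDerivAt_id x).mul ih).const_add (a : ℝ)
    refine h.congr_deriv ?_
    simp [pder, ev_padd, ev]

lemma ev_eq_zero_of_pzero {p : List ℚ} (h : pzero p = true) (x : ℝ) : ev p x = 0 := by
  induction p with
  | nil => simp [ev]
  | cons a p ih =>
    simp only [pzero, Bool.and_eq_true, decide_eq_true_eq] at h
    simp [ev, h.1, ih h.2]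

/-- Under 2q - 1 = cos θ the three-term recurrence, with factor 2(2q - 1) = -2 + 4q, produces
cos(kθ), so each term is bounded by the absolute value of its coefficient. -/
lemma abs_ev_chebComb {q θ : ℝ} (hq : 2 * q - 1 = Real.cos θ) (r : List ℚ) :
    ∀ (n : ℕ) (t u : List ℚ), ev t q = Real.cos (n * θ) → ev u q = Real.cos ((n + 1 : ℕ) * θ) →
      |ev (chebComb r t u) q| ≤ absSum r := by
  induction r with
  | nil => intro n t u _ _; simp [chebComb, ev, absSum]
  | cons c r ih =>
    intro n t u ht hu
    have hv : ev (padd (pmul [-2, 4] u) (psmul (-1) t)) q = Real.cos ((n + 1 + 1 : ℕ) * θ) := by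
      have h1 : ((n + 1 + 1 : ℕ) : ℝ) * θ = (n + 1 : ℕ) * θ + θ := by push_cast; ring
      have h2 : (n : ℝ) * θ = (n + 1 : ℕ) * θ - θ := by push_cast; ring
      rw [ev_padd, ev_pmul, ev_psmul, ht, hu, h1, h2, Real.cos_add, Real.cos_sub]
      simp only [ev]
      push_cast
      linear_combination 2 * Real.cos ((n + 1) * θ) * hq
    have h3 := ih (n + 1) u _ hu hv
    simp only [chebComb, absSum, ev_padd, ev_psmul, ht]
    push_cast
    refine (abs_add_le _ _).trans (add_le_add ?_ h3)
    rw [abs_mul]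
    exact mul_le_of_le_one_right (abs_nonneg _) (Real.abs_cos_le_one _)

/-- A polynomial approximation of the logarithm of a polynomial `g`, certified by the expansion of
`g' - g P'` in Chebyshev polynomials. -/
lemma abs_log_ev_sub_le {g P r : List ℚ} {M m : ℚ}
    (hcert : pzero (padd (pder g) (psmul (-1) (padd (pmul g (pder P))
      (chebComb r [1] [-1, 2])))) = true)
    (hm : 0 < m) (hg : ∀ q ∈ Set.Icc (0 : ℝ) 1, (m : ℝ) ≤ ev g q) (hM : absSum r ≤ M * m)
    {q : ℝ} (hq : q ∈ Set.Icc (0 : ℝ) 1) :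
    |(Real.log (ev g q) - ev P q) - (Real.log (ev g 0) - ev P 0)| ≤ M * q := by
  have hm' : (0 : ℝ) < m := by exact_mod_cast hm
  have hd : ∀ x ∈ Set.Icc (0 : ℝ) 1, HasDerivWithinAt (fun x => Real.log (ev g x) - ev P x)
      (ev (pder g) x / ev g x - ev (pder P) x) (Set.Icc 0 1) x := fun x hx =>
    (((hasDerivAt_ev g x).log (hm'.trans_le (hg x hx)).ne').sub
      (hasDerivAt_ev P x)).hasDerivWithinAt
  -- The derivative of log g - P is (g' - g P')/g. The certificate writes the numerator as a
  -- Chebyshev combination of size at most M m, and g ≥ m. The mean value inequality then gives the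
  -- factor q.
  have hb : ∀ x ∈ Set.Icc (0 : ℝ) 1, ‖ev (pder g) x / ev g x - ev (pder P) x‖ ≤ M := by
    intro x hx
    have hgx := hg x hx
    have hg0 := hm'.trans_le hgx
    have h0 := ev_eq_zero_of_pzero hcert x
    simp only [ev_padd, ev_psmul, ev_pmul] at h0
    have hx2 : 2 * x - 1 = Real.cos (Real.arccos (2 * x - 1)) :=
      (Real.cos_arccos (by linarith [hx.1]) (by linarith [hx.2])).symm
    have h1 := abs_ev_chebComb hx2 r 0 [1] [-1, 2] (by simp [ev])
      (by rw [zero_add, Nat.cast_one, one_mul, ← hx2]; simp only [ev]; push_cast; ring)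
    have h2 : ev (pder g) x / ev g x - ev (pder P) x
        = ev (chebComb r [1] [-1, 2]) x / ev g x := by
      field_simp
      push_cast at h0
      linarith
    rw [h2, norm_div, Real.norm_eq_abs, Real.norm_of_nonneg hg0.le, div_le_iff₀ hg0]
    have hM' : (absSum r : ℝ) ≤ M * m := by exact_mod_cast hM
    have hM0 : (0 : ℝ) ≤ M := by
      have : 0 ≤ (M : ℝ) * m := (abs_nonneg _).trans (h1.trans hM')
      exact nonneg_of_mul_nonneg_left this hm'
    exact h1.trans (hM'.trans (mul_le_mul_of_nonneg_left hgx hM0))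
  have h := (convex_Icc (0 : ℝ) 1).norm_image_sub_le_of_norm_hasDerivWithin_le hd hb
    (Set.left_mem_Icc.2 zero_le_one) hq
  simpa [abs_of_nonneg hq.1] using h

/-! ### Integrals of polynomials against powers of the logarithm -/

/-- The weight `(-log q) ^ (m + 1) / (1 - q²)`. -/
def wt (m : ℕ) (q : ℝ) : ℝ := (-Real.log q) ^ (m + 1) / (1 - q ^ 2)

/-- The moments of `wt m` on the unit interval. -/
def mom (m n : ℕ) : ℝ := ∫ q in Set.Ioo (0 : ℝ) 1, wt m q * q ^ n

lemma wt_nonneg (m : ℕ) {q : ℝ} (hq : q ∈ Set.Ioo (0 : ℝ) 1) : 0 ≤ wt m q :=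
  div_nonneg (pow_nonneg (neg_log_pos_of_mem hq).le _) (by nlinarith [hq.1, hq.2])

lemma measurable_wt (m : ℕ) : Measurable (wt m) := by unfold wt; fun_prop

/-- The factor 1 - q² in q^n - q^{n+2} cancels the denominator of the weight. -/
lemma mom_eq_add (m n : ℕ) :
    mom m n = mom m (n + 2) + (m + 1).factorial / (n + 1 : ℝ) ^ (m + 2) := by
  rw [← sub_eq_iff_eq_add']
  simp only [mom, wt]
  rw [← integral_sub (integrableOn_logMoment m n)
    (integrableOn_logMoment m (n + 2)), ← integral_neg_log_pow_mul_pow (m + 1) n]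
  refine setIntegral_congr_fun measurableSet_Ioo fun q hq => ?_
  have : 1 - q ^ 2 ≠ 0 := by nlinarith [hq.1, hq.2]
  field_simp
  ring

/-- The rational numbers `(m + 1)! / (n + 1) ^ (m + 2)`. -/
def momStep (m n : ℕ) : ℚ := (m + 1).factorial / (n + 1 : ℚ) ^ (m + 2)

/-- The coefficients of the reduction of the `wt m`-integral of `q ^ n * p q` to
`mom m n` and `mom m (n + 1)`. -/
def momRed (m : ℕ) : List ℚ → ℕ → ℚ × ℚ × ℚ
  | [], _ => (0, 0, 0)
  | a :: p, n =>
    let s := momRed m p (n + 1)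
    (a + s.2.1, s.1, s.2.2 + s.2.1 * momStep m n)

/-- Horner recursion: the tail of the polynomial reduces to moments n + 1 and n + 2, and
`mom_eq_add` trades the latter for moment n. Every integral thus reduces to the moments 0 and 1 with
exact rational arithmetic. -/
lemma integral_wt_mul_ev_aux (m : ℕ) (p : List ℚ) : ∀ n : ℕ,
    IntegrableOn (fun q => wt m q * (q ^ n * ev p q)) (Set.Ioo 0 1) ∧
    ∫ q in Set.Ioo (0 : ℝ) 1, wt m q * (q ^ n * ev p q) = (momRed m p n).1 * mom m n
      + (momRed m p n).2.1 * mom m (n + 1) - (momRed m p n).2.2 := by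
  induction p with
  | nil => intro n; simp [ev, momRed]
  | cons a p ih =>
    intro n
    obtain ⟨h1, h2⟩ := ih (n + 1)
    have h3 : IntegrableOn (fun q => (a : ℝ) * (wt m q * q ^ n)) (Set.Ioo 0 1) :=
      (integrableOn_logMoment m n).const_mul _
    have he : (fun q => wt m q * (q ^ n * ev (a :: p) q))
        = fun q => (a : ℝ) * (wt m q * q ^ n) + wt m q * (q ^ (n + 1) * ev p q) := by
      funext q; simp only [ev]; ring
    rw [he]
    refine ⟨h3.add h1, ?_⟩
    rw [integral_add h3 h1, h2, integral_const_mul, ← mom]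
    have h4 := mom_eq_add m n
    have h5 : ((momStep m n : ℚ) : ℝ) = (m + 1).factorial / (n + 1 : ℝ) ^ (m + 2) := by
      simp [momStep]
    simp only [momRed]
    push_cast
    rw [h5]
    rw [show n + 1 + 1 = n + 2 from rfl]
    linear_combination (-(momRed m p (n + 1)).2.1 : ℝ) * h4

lemma integrableOn_wt_mul_ev (m : ℕ) (p : List ℚ) :
    IntegrableOn (fun q => wt m q * ev p q) (Set.Ioo 0 1) := by
  simpa using (integral_wt_mul_ev_aux m p 0).1

lemma integral_wt_mul_ev (m : ℕ) (p : List ℚ) :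
    ∫ q in Set.Ioo (0 : ℝ) 1, wt m q * ev p q = (momRed m p 0).1 * mom m 0
      + (momRed m p 0).2.1 * mom m 1 - (momRed m p 0).2.2 := by
  simpa using (integral_wt_mul_ev_aux m p 0).2

lemma mom_eq_of_hasSum {m n : ℕ} {s : ℝ}
    (h : HasSum (fun j : ℕ => 1 / (2 * j + (n + 1) : ℝ) ^ (m + 2)) s) :
    mom m n = (m + 1).factorial * s := by
  refine (hasSum_integral_logMoment m n).unique ((h.mul_left _).congr_fun fun j => ?_)
  rw [mul_one_div, show (n + 2 * j + 1 : ℝ) = 2 * j + (n + 1) by ring]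

lemma mom_zero_zero : mom 0 0 = Real.pi ^ 2 / 8 := by
  rw [mom_eq_of_hasSum (m := 0) (n := 0) (s := Real.pi ^ 2 / 6 - Real.pi ^ 2 / 6 / 2 ^ 2)]
  · norm_num; ring
  · simpa using (hasSum_even_odd two_ne_zero hasSum_zeta_two).2

lemma mom_zero_one : mom 0 1 = Real.pi ^ 2 / 24 := by
  rw [mom_eq_of_hasSum (m := 0) (n := 1) (s := Real.pi ^ 2 / 6 / 2 ^ 2)]
  · norm_num; ring
  · have := (hasSum_even_odd two_ne_zero hasSum_zeta_two).1
    refine this.congr_fun fun j => ?_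
    norm_num

lemma mom_one_zero : mom 1 0 = 7 / 4 * zetaThree := by
  rw [mom_eq_of_hasSum (m := 1) (n := 0) (s := zetaThree - zetaThree / 2 ^ 3)]
  · norm_num; ring
  · simpa using (hasSum_even_odd three_ne_zero hasSum_zetaThree).2

lemma mom_one_one : mom 1 1 = zetaThree / 4 := by
  rw [mom_eq_of_hasSum (m := 1) (n := 1) (s := zetaThree / 2 ^ 3)]
  · norm_num; ring
  · have := (hasSum_even_odd three_ne_zero hasSum_zetaThree).1
    refine this.congr_fun fun j => ?_
    norm_num

lemma mom_two_zero : mom 2 0 = Real.pi ^ 4 / 16 := by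
  rw [mom_eq_of_hasSum (m := 2) (n := 0) (s := Real.pi ^ 4 / 90 - Real.pi ^ 4 / 90 / 2 ^ 4)]
  · norm_num [Nat.factorial]; ring
  · simpa using (hasSum_even_odd four_ne_zero hasSum_zeta_four).2

/-! ### Bounds for `ζ(3)` -/

/-- The tail is compared with the telescoping function 1/(2(x - ½)² + c): c = ½ gives a lower bound,
and the slightly smaller c = 999/2000 an upper bound once x ≥ 31. The term n = 0 is 0 by the
convention for division. -/
lemma zetaThree_sub_sum_mem :
    1 / (2 * (30 + 1 / 2 : ℝ) ^ 2 + 1 / 2) ≤ zetaThree - ∑ n ∈ Finset.range 31, 1 / (n : ℝ) ^ 3 ∧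
    zetaThree - ∑ n ∈ Finset.range 31, 1 / (n : ℝ) ^ 3
      ≤ 1 / (2 * (30 + 1 / 2 : ℝ) ^ 2 + 999 / 2000) := by
  set S : ℕ → ℝ := fun k => ∑ n ∈ Finset.range (k + 31), 1 / (n : ℝ) ^ 3 with hS
  have hlim : Tendsto S atTop (𝓝 zetaThree) :=
    hasSum_zetaThree.tendsto_sum_nat.comp (tendsto_add_atTop_nat 31)
  have hstep : ∀ k, S (k + 1) = S k + 1 / ((k : ℝ) + 31) ^ 3 := fun k => by
    simp only [hS]
    rw [show k + 1 + 31 = k + 31 + 1 by ring, Finset.sum_range_succ]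
    push_cast
    rfl
  have hf : ∀ c : ℝ, 0 ≤ c → Tendsto (fun k : ℕ => S k + 1 / (2 * (k + 30 + 1 / 2 : ℝ) ^ 2 + c))
      atTop (𝓝 zetaThree) := fun c hc => by
    have h1 : Tendsto (fun k : ℕ => 1 / (2 * (k + 30 + 1 / 2 : ℝ) ^ 2 + c)) atTop (𝓝 0) := by
      refine squeeze_zero (fun k => by positivity) (fun k => ?_)
        tendsto_one_div_add_atTop_nhds_zero_nat
      have hk := k.cast_nonneg (α := ℝ)
      exact one_div_le_one_div_of_le (by positivity) (by nlinarith)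
    simpa using hlim.add h1
  constructor
  · have hmono : Monotone fun k : ℕ => S k + 1 / (2 * (k + 30 + 1 / 2 : ℝ) ^ 2 + 1 / 2) := by
      refine monotone_nat_of_le_succ fun k => ?_
      rw [hstep]
      push_cast
      have hk := k.cast_nonneg (α := ℝ)
      set x : ℝ := k + 31 with hx
      have hx1 : (31 : ℝ) ≤ x := by linarith
      have e1 : (k : ℝ) + 30 + 1 / 2 = x - 1 / 2 := by rw [hx]; ring
      have e2 : (k : ℝ) + 1 + 30 + 1 / 2 = x + 1 / 2 := by rw [hx]; ring
      rw [e1, e2]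
      -- The factorization (2x² - 2x + 1)(2x² + 2x + 1) = 4x⁴ + 1.
      have h : 1 / (2 * (x - 1 / 2) ^ 2 + 1 / 2) - 1 / (2 * (x + 1 / 2) ^ 2 + 1 / 2)
          = 4 * x / (4 * x ^ 4 + 1) := by
        have a1 : 0 < 2 * (x - 1 / 2) ^ 2 + 1 / 2 := by positivity
        have a2 : 0 < 2 * (x + 1 / 2) ^ 2 + 1 / 2 := by positivity
        rw [div_sub_div _ _ a1.ne' a2.ne', div_eq_div_iff (by positivity) (by positivity)]
        ring
      have h2 : 4 * x / (4 * x ^ 4 + 1) ≤ 1 / x ^ 3 := by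
        rw [div_le_div_iff₀ (by positivity) (by positivity)]
        nlinarith
      linarith
    have := hmono.ge_of_tendsto (hf (1 / 2) (by norm_num)) 0
    simp only [hS, Nat.cast_zero, zero_add] at this
    linarith
  · have hanti : Antitone fun k : ℕ => S k + 1 / (2 * (k + 30 + 1 / 2 : ℝ) ^ 2 + 999 / 2000) := by
      refine antitone_nat_of_succ_le fun k => ?_
      rw [hstep]
      push_cast
      have hk := k.cast_nonneg (α := ℝ)
      set x : ℝ := k + 31 with hx
      have hx1 : (31 : ℝ) ≤ x := by linarith
      have e1 : (k : ℝ) + 30 + 1 / 2 = x - 1 / 2 := by rw [hx]; ring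
      have e2 : (k : ℝ) + 1 + 30 + 1 / 2 = x + 1 / 2 := by rw [hx]; ring
      rw [e1, e2]
      have hx2 : 31 * 31 ≤ x ^ 2 := by nlinarith
      have hden : 0 < 4 * x ^ 4 - 1 / 500 * x ^ 2 + (1999 / 2000) ^ 2 := by nlinarith
      have h : 1 / (2 * (x - 1 / 2) ^ 2 + 999 / 2000) - 1 / (2 * (x + 1 / 2) ^ 2 + 999 / 2000)
          = 4 * x / (4 * x ^ 4 - 1 / 500 * x ^ 2 + (1999 / 2000) ^ 2) := by
        have a1 : 0 < 2 * (x - 1 / 2) ^ 2 + 999 / 2000 := by positivity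
        have a2 : 0 < 2 * (x + 1 / 2) ^ 2 + 999 / 2000 := by positivity
        rw [div_sub_div _ _ a1.ne' a2.ne', div_eq_div_iff (by positivity) hden.ne']
        ring
      have h2 : 1 / x ^ 3 ≤ 4 * x / (4 * x ^ 4 - 1 / 500 * x ^ 2 + (1999 / 2000) ^ 2) := by
        rw [div_le_div_iff₀ (by positivity) hden]
        nlinarith
      linarith
    have := hanti.le_of_tendsto (hf (999 / 2000) (by norm_num)) 0
    simp only [hS, Nat.cast_zero, zero_add] at this
    linarith

lemma zetaThree_gt : 1.20205690 < zetaThree := by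
  have h := zetaThree_sub_sum_mem.1
  norm_num [Finset.sum_range_succ] at h
  norm_num
  linarith

lemma zetaThree_lt : zetaThree < 1.20205691 := by
  have h := zetaThree_sub_sum_mem.2
  norm_num [Finset.sum_range_succ] at h
  norm_num
  linarith

/-! ### The numerical values of `c₁` and `c₂` -/

/-- Approximation of `log ((1 + 2 q + 5 q²) / 4)` on the unit interval. -/
def polyA : List ℚ := [
    -693147/500000, 1999903/1000000, 1504333/500000, -750291/100000, 195487/40000,
    11120161/1000000, -4227213/125000, 8767179/200000, -32216299/1000000, 1627279/125000,
    -1126839/500000]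

/-- Approximation of `log ((1 - 2 q + 5 q²) / 4)` on the unit interval. -/
def polyA' : List ℚ := [
    -693147/500000, -1999663/1000000, 2946941/1000000, 4569823/500000, -22981901/1000000,
    190661567/1000000, -19670287/20000, 32079817/12500, -1967212089/500000, 3753966493/1000000,
    -552452003/250000, 738702391/1000000, -53844001/500000]

/-- Approximation of `log ((5 + 2 q + q²) / 4)` on the unit interval. -/
def polyB : List ℚ := [
    27893/125000, 399989/1000000, 24063/200000, -60599/1000000, 10297/1000000]

/-- Approximation of `log ((5 - 2 q + q²) / 4)` on the unit interval. -/
def polyB' : List ℚ := [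
    27893/125000, -399999/1000000, 6001/50000, 58169/1000000, 7893/1000000, -4613/500000]

lemma log_five_div_four_mem : |Real.log (5 / 4) - 0.223144| ≤ 0.000001 := by
  have h := Real.abs_log_sub_add_sum_range_le (x := -1 / 4) (by norm_num [abs_lt]) 12
  norm_num [Finset.sum_range_succ] at h
  rw [abs_le] at h ⊢
  constructor <;> norm_num <;> linarith [h.1, h.2]

lemma log_one_div_four_mem : |Real.log (1 / 4) - (-1.386294)| ≤ 0.000001 := by
  have h1 := Real.log_two_gt_d9
  have h2 := Real.log_two_lt_d9
  have h : Real.log (1 / 4) = -(2 * Real.log 2) := by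
    rw [one_div, Real.log_inv, show (4 : ℝ) = 2 ^ 2 by norm_num, Real.log_pow]; norm_num
  rw [h, abs_le]
  constructor <;> norm_num at * <;> linarith

/-- The error bound has a constant part, the error at q = 0 from the rounded constant term, and a
part M q from the derivative certificate. -/
lemma abs_log_div_four_sub_le {g P r : List ℚ} {M m : ℚ}
    (hcert : pzero (padd (pder g) (psmul (-1) (padd (pmul g (pder P))
      (chebComb r [1] [-1, 2])))) = true)
    (hm : 0 < m) (hg : ∀ q ∈ Set.Icc (0 : ℝ) 1, (m : ℝ) ≤ ev g q) (hM : absSum r ≤ M * m)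
    (h0 : |Real.log (ev g 0 / 4) - ev P 0| ≤ 0.000001)
    {q : ℝ} (hq : q ∈ Set.Icc (0 : ℝ) 1) :
    |Real.log (ev g q / 4) - ev P q| ≤ ev [1/1000000, M] q := by
  have hm' : (0 : ℝ) < m := by exact_mod_cast hm
  have h := abs_log_ev_sub_le hcert hm hg hM hq
  have hlog : ∀ x ∈ Set.Icc (0 : ℝ) 1, Real.log (ev g x / 4) = Real.log (ev g x) - Real.log 4 :=
    fun x hx => Real.log_div (hm'.trans_le (hg x hx)).ne' (by norm_num)
  rw [hlog 0 (Set.left_mem_Icc.2 zero_le_one)] at h0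
  rw [hlog q hq]
  have h3 := abs_add_le ((Real.log (ev g q) - ev P q) - (Real.log (ev g 0) - ev P 0))
    (Real.log (ev g 0) - Real.log 4 - ev P 0)
  rw [show (Real.log (ev g q) - ev P q) - (Real.log (ev g 0) - ev P 0)
    + (Real.log (ev g 0) - Real.log 4 - ev P 0) = Real.log (ev g q) - Real.log 4 - ev P q by
      ring] at h3
  simp only [ev]
  push_cast
  norm_num at h0 ⊢
  linarith

lemma abs_sub_polyA {q : ℝ} (hq : q ∈ Set.Icc (0 : ℝ) 1) :
    |Real.log (ev [1, 2, 5] q / 4) - ev polyA q| ≤ ev [1/1000000, 265/1000000] q := by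
  refine abs_log_div_four_sub_le (m := 1) (r := [
    1649033/131072000000, 227293/10485760000, 1861501/131072000000, 378967/52428800000,
    92553/32768000000, 87791/104857600000, 47793/262144000000, 13917/524288000000,
    211/131072000000, -119/524288000000, 7901457/52428800000, 1126839/20971520000])
    (by decide +kernel) (by norm_num) (fun q hq => ?_) (by decide +kernel) ?_ hq
  · simp only [ev]
    push_cast
    nlinarith [hq.1]
  · have := log_one_div_four_mem
    norm_num [ev, polyA] at this ⊢
    exact this

lemma abs_sub_polyA' {q : ℝ} (hq : q ∈ Set.Icc (0 : ℝ) 1) :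
    |Real.log (ev [1, -2, 5] q / 4) - ev polyA' q| ≤ ev [1/1000000, 473/1000000] q := by
  -- The minimum of 1 - 2q + 5q², attained at q = 1/5.
  refine abs_log_div_four_sub_le (m := 4 / 5) (r := [
    31124189/4194304000000, 13584179/1048576000000, 2024943/209715200000, 23992937/4194304000000,
    23659077/8388608000000, 4789141/4194304000000, 820287/2097152000000, 241793/2097152000000,
    24511/838860800000, 13257/2097152000000, 2411/2097152000000, 691/4194304000000,
    -1214822773/8388608000000, 161532003/838860800000])
    (by decide +kernel) (by norm_num) (fun q hq => ?_) (by decide +kernel) ?_ hq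
  · simp only [ev]
    push_cast
    nlinarith [sq_nonneg (5 * q - 1)]
  · have := log_one_div_four_mem
    norm_num [ev, polyA'] at this ⊢
    exact this

lemma abs_sub_polyB {q : ℝ} (hq : q ∈ Set.Icc (0 : ℝ) 1) :
    |Real.log (ev [5, 2, 1] q / 4) - ev polyB q| ≤ ev [1/1000000, 28/1000000] q := by
  refine abs_log_div_four_sub_le (m := 5) (r := [
    1449/128000000, 779/64000000, 1/256000, 99/128000000, -3549/128000000, -10297/128000000])
    (by decide +kernel) (by norm_num) (fun q hq => ?_) (by decide +kernel) ?_ hq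
  · simp only [ev]
    push_cast
    nlinarith [hq.1]
  · have := log_five_div_four_mem
    norm_num [ev, polyB] at this ⊢
    exact this

lemma abs_sub_polyB' {q : ℝ} (hq : q ∈ Set.Icc (0 : ℝ) 1) :
    |Real.log (ev [5, -2, 1] q / 4) - ev polyB' q| ≤ ev [1/1000000, 16/1000000] q := by
  refine abs_log_div_four_sub_le (m := 4) (r := [
    -1197/512000000, -689/128000000, -2697/1024000000, -141/256000000, -27/512000000,
    7279/256000000, 4613/204800000])
    (by decide +kernel) (by norm_num) (fun q hq => ?_) (by decide +kernel) ?_ hq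
  · simp only [ev]
    push_cast
    nlinarith [sq_nonneg (q - 1)]
  · have := log_five_div_four_mem
    norm_num [ev, polyB'] at this ⊢
    exact this

/-- The function whose norms are `c₁` and `c₂`. -/
def bump (t : ℝ) : ℝ := Real.log (1 + 1 / (1 - t) ^ 2)

lemma measurable_bump : Measurable bump := by unfold bump; fun_prop

lemma bump_nonneg (t : ℝ) : 0 ≤ bump t :=
  Real.log_nonneg (le_add_of_nonneg_right (by positivity))

/-- The points z and 1/z both tend to the singularity t = 1 as q → 0 and produce the term -2 log q;
at -z and -1/z the function is regular. What remains is the logarithm of a quadratic that is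
positive on [0, 1]. -/
lemma bump_cayley {q : ℝ} (hq : q ∈ Set.Ioo (0 : ℝ) 1) :
    bump (cayley q) = Real.log (ev [1, 2, 5] q / 4) + 2 * -Real.log q ∧
    bump (-cayley q) = Real.log (ev [5, 2, 1] q / 4) ∧
    bump (cayley q)⁻¹ = Real.log (ev [1, -2, 5] q / 4) + 2 * -Real.log q ∧
    bump (-(cayley q)⁻¹) = Real.log (ev [5, -2, 1] q / 4) := by
  have h0 := hq.1
  have h1 : 0 < 1 - q := by linarith [hq.2]
  have hsq : 2 * -Real.log q = -Real.log (q ^ 2) := by rw [Real.log_pow]; push_cast; ring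
  have hA : 0 < ev [1, 2, 5] q := by simp only [ev]; push_cast; nlinarith
  have hA' : 0 < ev [1, -2, 5] q := by
    simp only [ev]; push_cast; nlinarith [sq_nonneg (5 * q - 1)]
  rw [hsq, ← sub_eq_add_neg, ← sub_eq_add_neg, ← Real.log_div (by positivity) (by positivity),
    ← Real.log_div (by positivity) (by positivity)]
  unfold bump cayley
  refine ⟨?_, ?_, ?_, ?_⟩ <;> congr 1 <;> simp only [ev] <;> push_cast
  · rw [show 1 - (1 - q) / (1 + q) = 2 * q / (1 + q) by field_simp; ring]
    field_simp
    ring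
  · rw [show 1 - -((1 - q) / (1 + q)) = 2 / (1 + q) by field_simp; ring]
    field_simp
    ring
  · rw [show 1 - ((1 - q) / (1 + q))⁻¹ = -(2 * q) / (1 - q) by field_simp; ring]
    field_simp
    ring
  · rw [show 1 - -((1 - q) / (1 + q))⁻¹ = 2 / (1 - q) by field_simp; ring]
    field_simp
    ring

lemma integral_approx {F T e : ℝ → ℝ} (hF : Measurable F) (hT : IntegrableOn T (Set.Ioo 0 1))
    (he : IntegrableOn e (Set.Ioo 0 1)) (h : ∀ q ∈ Set.Ioo (0 : ℝ) 1, |F q - T q| ≤ e q) :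
    IntegrableOn F (Set.Ioo 0 1) ∧
    |(∫ q in Set.Ioo (0 : ℝ) 1, F q) - ∫ q in Set.Ioo (0 : ℝ) 1, T q|
      ≤ ∫ q in Set.Ioo (0 : ℝ) 1, e q := by
  have hae : ∀ᵐ q ∂(volume.restrict (Set.Ioo (0 : ℝ) 1)), ‖F q - T q‖ ≤ e q :=
    (ae_restrict_iff' measurableSet_Ioo).2 (ae_of_all _ h)
  have hd : IntegrableOn (fun q => F q - T q) (Set.Ioo 0 1) :=
    he.mono' (hF.aestronglyMeasurable.sub hT.aestronglyMeasurable) hae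
  have hFi : IntegrableOn F (Set.Ioo 0 1) :=
    (hd.add hT).congr (ae_of_all _ fun q => by simp)
  refine ⟨hFi, ?_⟩
  rw [← integral_sub hFi hT]
  exact norm_integral_le_of_norm_le he hae

lemma wt_one_eq (q : ℝ) : wt 1 q = wt 0 q * -Real.log q := by unfold wt; ring

lemma wt_two_eq (q : ℝ) : wt 2 q = wt 0 q * (-Real.log q) ^ 2 := by unfold wt; ring

lemma measurable_cayley : Measurable cayley := by unfold cayley; fun_prop

/-- The sum of the four approximating polynomials. -/
def polySum : List ℚ := padd (padd polyA polyB) (padd polyA' polyB')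

/-- The sum of the squares of the four approximating polynomials. -/
def polySqSum : List ℚ := padd (padd (pmul polyA polyA) (pmul polyB polyB))
  (padd (pmul polyA' polyA') (pmul polyB' polyB'))

/-- So many digits are needed because of cancellation: in the integral of `polySqSum` the value π²
is multiplied by coefficients of order 10⁷. -/
lemma pi_sq_bounds : 9.86960440108935 < Real.pi ^ 2 ∧ Real.pi ^ 2 < 9.86960440108936 := by
  have h1 := Real.pi_gt_d20
  have h2 := Real.pi_lt_d20
  constructor <;> nlinarith

lemma momRed_polySum : (momRed 0 polySum 0).1 = -7317929117/1000000 ∧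
    (momRed 0 polySum 0).2.1 = 7319315409/1000000 ∧
    -6016.471092 ≤ (momRed 0 polySum 0).2.2 ∧ (momRed 0 polySum 0).2.2 ≤ -6016.471091 := by
  decide +kernel

lemma momRed_polyAA' : (momRed 1 (padd polyA polyA') 0).1 = -731863393/100000 ∧
    (momRed 1 (padd polyA polyA') 0).2.1 = 292773083/40000 ∧
    -13190.64509 ≤ (momRed 1 (padd polyA polyA') 0).2.2 ∧
    (momRed 1 (padd polyA polyA') 0).2.2 ≤ -13190.64508 := by
  decide +kernel

lemma momRed_polySqSum : (momRed 0 polySqSum 0).1 = 10533163174445067899/100000000000 ∧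
    (momRed 0 polySqSum 0).2.1 = -5266581539177326903/50000000000 ∧
    86631791.7359 ≤ (momRed 0 polySqSum 0).2.2 ∧
    (momRed 0 polySqSum 0).2.2 ≤ 86631791.7360 := by
  decide +kernel

/-! ### Integrals of the function defining `c₁` and `c₂` -/

lemma integral_wt_zero_polySum_mem :
    |(∫ q in Set.Ioo (0 : ℝ) 1, wt 0 q * ev polySum q)
      - ((-7317929117 / 1000000) * (Real.pi ^ 2 / 8) + (7319315409 / 1000000) * (Real.pi ^ 2 / 24)
        + 6016.4710915)| ≤ 0.000001 := by
  obtain ⟨h1, h2, h3, h4⟩ := momRed_polySum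
  have h3' : ((-6016.471092 : ℚ) : ℝ) ≤ (momRed 0 polySum 0).2.2 := Rat.cast_le.2 h3
  have h4' : (((momRed 0 polySum 0).2.2 : ℚ) : ℝ) ≤ (-6016.471091 : ℚ) := Rat.cast_le.2 h4
  rw [integral_wt_mul_ev, h1, h2, mom_zero_zero, mom_zero_one, abs_le]
  push_cast at *
  constructor <;> linarith

lemma integral_wt_one_polyAA'_mem :
    |(∫ q in Set.Ioo (0 : ℝ) 1, wt 1 q * ev (padd polyA polyA') q)
      - ((-731863393 / 100000) * (7 / 4 * zetaThree) + (292773083 / 40000) * (zetaThree / 4)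
        + 13190.645085)| ≤ 0.00001 := by
  obtain ⟨h1, h2, h3, h4⟩ := momRed_polyAA'
  have h3' : ((-13190.64509 : ℚ) : ℝ) ≤ (momRed 1 (padd polyA polyA') 0).2.2 := Rat.cast_le.2 h3
  have h4' : (((momRed 1 (padd polyA polyA') 0).2.2 : ℚ) : ℝ) ≤ (-13190.64508 : ℚ) :=
    Rat.cast_le.2 h4
  rw [integral_wt_mul_ev, h1, h2, mom_one_zero, mom_one_one, abs_le]
  push_cast at *
  constructor <;> linarith

lemma integral_wt_zero_polySqSum_mem :
    |(∫ q in Set.Ioo (0 : ℝ) 1, wt 0 q * ev polySqSum q)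
      - ((10533163174445067899 / 100000000000) * (Real.pi ^ 2 / 8)
        + (-5266581539177326903 / 50000000000) * (Real.pi ^ 2 / 24) - 86631791.73595)|
      ≤ 0.0001 := by
  obtain ⟨h1, h2, h3, h4⟩ := momRed_polySqSum
  have h3' : ((86631791.7359 : ℚ) : ℝ) ≤ (momRed 0 polySqSum 0).2.2 := Rat.cast_le.2 h3
  have h4' : (((momRed 0 polySqSum 0).2.2 : ℚ) : ℝ) ≤ (86631791.7360 : ℚ) := Rat.cast_le.2 h4
  rw [integral_wt_mul_ev, h1, h2, mom_zero_zero, mom_zero_one, abs_le]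
  push_cast at *
  constructor <;> linarith

lemma integral_wt_const (m : ℕ) (a : ℚ) :
    ∫ q in Set.Ioo (0 : ℝ) 1, wt m q * ev [a] q = a * mom m 0 := by
  rw [integral_wt_mul_ev]; simp [momRed]

lemma integral_wt_linear (m : ℕ) (a b : ℚ) :
    ∫ q in Set.Ioo (0 : ℝ) 1, wt m q * ev [a, b] q = a * mom m 0 + b * mom m 1 := by
  rw [integral_wt_mul_ev]; simp [momRed]

/-- The sum of the values of `f` at the four points `± c ^ (± 1)`, where `c = cayley q`. -/
def orbitSum (f : ℝ → ℝ) (q : ℝ) : ℝ :=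
  (f (cayley q) + f (-cayley q)) + (f (cayley q)⁻¹ + f (-(cayley q)⁻¹))

lemma measurable_wt_mul_orbitSum {f : ℝ → ℝ} (hf : Measurable f) :
    Measurable fun q => wt 0 q * orbitSum f q := by
  have h := measurable_cayley
  refine (measurable_wt 0).mul ?_
  unfold orbitSum
  exact ((hf.comp h).add (hf.comp h.neg)).add ((hf.comp h.inv).add (hf.comp h.inv.neg))

lemma integral_muR_orbitSum {f : ℝ → ℝ} (hf : Measurable f) (hf0 : ∀ t, 0 ≤ f t)
    (hi : IntegrableOn (fun q => wt 0 q * orbitSum f q) (Set.Ioo 0 1)) :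
    ∫ t, f t ∂muR = 2 / Real.pi ^ 2 * ∫ q in Set.Ioo (0 : ℝ) 1, wt 0 q * orbitSum f q := by
  simp only [wt, zero_add, pow_one, orbitSum] at hi ⊢
  exact (integral_muR_cayley hf hf0 hi).2

/-- The four points contribute 4(-log q) in total, carried by the weight `wt 1`, plus the four
logarithms; the four approximation errors add up, 265 + 473 + 28 + 16 = 782. -/
lemma abs_orbitSum_bump_sub_le {q : ℝ} (hq : q ∈ Set.Ioo (0 : ℝ) 1) :
    |wt 0 q * orbitSum bump q - (wt 1 q * ev [4] q + wt 0 q * ev polySum q)|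
      ≤ wt 0 q * ev [4/1000000, 782/1000000] q := by
  have hq' := Set.Ioo_subset_Icc_self hq
  obtain ⟨hA, hB, hA', hB'⟩ := bump_cayley hq
  have dA := abs_le.1 (abs_sub_polyA hq')
  have dA' := abs_le.1 (abs_sub_polyA' hq')
  have dB := abs_le.1 (abs_sub_polyB hq')
  have dB' := abs_le.1 (abs_sub_polyB' hq')
  have hw := wt_nonneg 0 hq
  rw [orbitSum, hA, hB, hA', hB', wt_one_eq, polySum, ev_padd, ev_padd, ev_padd]
  generalize Real.log (ev [1, 2, 5] q / 4) = E₁ at *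
  generalize Real.log (ev [1, -2, 5] q / 4) = E₂ at *
  generalize Real.log (ev [5, 2, 1] q / 4) = E₃ at *
  generalize Real.log (ev [5, -2, 1] q / 4) = E₄ at *
  generalize ev polyA q = P₁ at *
  generalize ev polyA' q = P₂ at *
  generalize ev polyB q = P₃ at *
  generalize ev polyB' q = P₄ at *
  simp only [ev] at *
  push_cast at *
  rw [show wt 0 q * (E₁ + 2 * -Real.log q + E₃ + (E₂ + 2 * -Real.log q + E₄)) -
      (wt 0 q * -Real.log q * (4 + q * 0) + wt 0 q * (P₁ + P₃ + (P₂ + P₄)))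
      = wt 0 q * ((E₁ - P₁) + (E₂ - P₂) + (E₃ - P₃) + (E₄ - P₄)) by ring, abs_mul, abs_of_nonneg hw]
  refine mul_le_mul_of_nonneg_left (abs_le.2 ⟨?_, ?_⟩) hw <;> linarith

lemma integral_bump_muR : Integrable bump muR ∧
    0.678 * 2 ≤ ∫ t, bump t ∂muR ∧ ∫ t, bump t ∂muR < 0.679 * 2 := by
  have hT1 := integrableOn_wt_mul_ev 1 [4]
  have hT0 := integrableOn_wt_mul_ev 0 polySum
  obtain ⟨hi, hb⟩ := integral_approx (measurable_wt_mul_orbitSum measurable_bump) (hT1.add hT0)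
    (integrableOn_wt_mul_ev 0 [4/1000000, 782/1000000]) fun q hq => abs_orbitSum_bump_sub_le hq
  simp only [Pi.add_apply] at hb
  rw [integral_add hT1 hT0, integral_wt_linear, integral_wt_const, mom_one_zero, mom_zero_zero,
    mom_zero_one, abs_le] at hb
  have hP := abs_le.1 integral_wt_zero_polySum_mem
  obtain ⟨hpi1, hpi2⟩ := pi_sq_bounds
  have hz1 := zetaThree_gt
  have hz2 := zetaThree_lt
  have hpos : 0 < Real.pi ^ 2 := by positivity
  refine ⟨?_, ?_⟩
  · refine (integral_muR_cayley measurable_bump bump_nonneg ?_).1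
    simpa only [wt, zero_add, pow_one, orbitSum] using hi
  rw [integral_muR_orbitSum measurable_bump bump_nonneg hi, div_mul_eq_mul_div, le_div_iff₀ hpos,
    div_lt_iff₀ hpos]
  push_cast at hb
  constructor <;> linarith [hb.1, hb.2, hP.1, hP.2]

lemma abs_log_le_of_mem {x : ℝ} (h1 : 1 / 5 ≤ x) (h2 : x ≤ 2) : |Real.log x| ≤ 1.65 := by
  have hx : 0 < x := by linarith
  have hl1 := Real.log_le_log (by norm_num) h1
  have hl2 := Real.log_le_log hx h2
  have h5 : Real.log (1 / 5) = -(Real.log (5 / 4) - Real.log (1 / 4)) := by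
    rw [← Real.log_div (by norm_num) (by norm_num), ← Real.log_inv]; norm_num
  have ha := abs_le.1 log_five_div_four_mem
  have hb := abs_le.1 log_one_div_four_mem
  have h2 := Real.log_two_lt_d9
  rw [abs_le]
  constructor <;> linarith [ha.1, ha.2, hb.1, hb.2]

/-- Here 3.4 = 2 · 1.65 + 0.1 bounds |E + P|, and 1.65 exceeds log 5, the largest absolute value of
the four logarithms. -/
lemma abs_sq_sub_sq_le {E P d : ℝ} (hE : |E| ≤ 1.65) (hd : |E - P| ≤ d) (hd1 : d ≤ 0.1) :
    |E ^ 2 - P ^ 2| ≤ 3.4 * d := by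
  have h : |E + P| ≤ 3.4 := by
    rw [abs_le] at *
    constructor <;> linarith [hE.1, hE.2, hd.1, hd.2]
  rw [show E ^ 2 - P ^ 2 = (E + P) * (E - P) by ring, abs_mul]
  exact mul_le_mul h hd (abs_nonneg _) (by norm_num)

/-- With L = -log q, the two singular points give (E + 2L)² = 4L² + 4LE + E². This accounts for the
coefficient 8 at `wt 2` and for the cross term with the two polynomials for z and 1/z, whose error
is 265 + 473 = 738. -/
lemma abs_orbitSum_bump_sq_sub_le {q : ℝ} (hq : q ∈ Set.Ioo (0 : ℝ) 1) :
    |wt 0 q * orbitSum (fun t => bump t ^ 2) q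
      - (wt 2 q * ev [8] q + 4 * (wt 1 q * ev (padd polyA polyA') q) + wt 0 q * ev polySqSum q)|
      ≤ 4 * (wt 1 q * ev [2/1000000, 738/1000000] q)
        + 3.4 * (wt 0 q * ev [4/1000000, 782/1000000] q) := by
  have hq' := Set.Ioo_subset_Icc_self hq
  have hq0 := hq.1
  have hq1 := hq.2
  obtain ⟨hA, hB, hA', hB'⟩ := bump_cayley hq
  have dA := abs_sub_polyA hq'
  have dA' := abs_sub_polyA' hq'
  have dB := abs_sub_polyB hq'
  have dB' := abs_sub_polyB' hq'
  have bA : |Real.log (ev [1, 2, 5] q / 4)| ≤ 1.65 := by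
    refine abs_log_le_of_mem ?_ ?_ <;> simp only [ev] <;> push_cast <;> nlinarith
  have bA' : |Real.log (ev [1, -2, 5] q / 4)| ≤ 1.65 := by
    refine abs_log_le_of_mem ?_ ?_ <;> simp only [ev] <;> push_cast <;>
      nlinarith [sq_nonneg (5 * q - 1)]
  have bB : |Real.log (ev [5, 2, 1] q / 4)| ≤ 1.65 := by
    refine abs_log_le_of_mem ?_ ?_ <;> simp only [ev] <;> push_cast <;> nlinarith
  have bB' : |Real.log (ev [5, -2, 1] q / 4)| ≤ 1.65 := by
    refine abs_log_le_of_mem ?_ ?_ <;> simp only [ev] <;> push_cast <;> nlinarith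
  have sA := abs_sq_sub_sq_le bA dA (by simp only [ev]; push_cast; linarith)
  have sA' := abs_sq_sub_sq_le bA' dA' (by simp only [ev]; push_cast; linarith)
  have sB := abs_sq_sub_sq_le bB dB (by simp only [ev]; push_cast; linarith)
  have sB' := abs_sq_sub_sq_le bB' dB' (by simp only [ev]; push_cast; linarith)
  have hw := wt_nonneg 0 hq
  have hL := (neg_log_pos_of_mem hq).le
  clear bA bA' bB bB' dB dB'
  simp only [orbitSum]
  rw [hA, hB, hA', hB', wt_one_eq, wt_two_eq, polySqSum]
  simp only [ev_padd, ev_pmul]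
  clear hA hB hA' hB'
  generalize Real.log (ev [1, 2, 5] q / 4) = E₁ at *
  generalize Real.log (ev [1, -2, 5] q / 4) = E₂ at *
  generalize Real.log (ev [5, 2, 1] q / 4) = E₃ at *
  generalize Real.log (ev [5, -2, 1] q / 4) = E₄ at *
  generalize ev polyA q = P₁ at *
  generalize ev polyA' q = P₂ at *
  generalize ev polyB q = P₃ at *
  generalize ev polyB' q = P₄ at *
  generalize wt 0 q = w at *
  generalize -Real.log q = L at *
  simp only [ev] at *
  push_cast at *
  have hd : |(E₁ - P₁) + (E₂ - P₂)| ≤ 2 / 1000000 + q * (738 / 1000000) := by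
    rw [abs_le] at *
    constructor <;> linarith
  have hs : |(E₁ ^ 2 - P₁ ^ 2) + (E₂ ^ 2 - P₂ ^ 2) + (E₃ ^ 2 - P₃ ^ 2) + (E₄ ^ 2 - P₄ ^ 2)|
      ≤ 3.4 * (4 / 1000000 + q * (782 / 1000000)) := by
    rw [abs_le] at *
    constructor <;> linarith
  calc _ = |4 * (w * L) * ((E₁ - P₁) + (E₂ - P₂)) + w * ((E₁ ^ 2 - P₁ ^ 2) + (E₂ ^ 2 - P₂ ^ 2)
        + (E₃ ^ 2 - P₃ ^ 2) + (E₄ ^ 2 - P₄ ^ 2))| := by congr 1; ring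
    _ ≤ 4 * (w * L) * (2 / 1000000 + q * (738 / 1000000))
        + w * (3.4 * (4 / 1000000 + q * (782 / 1000000))) := by
      refine (abs_add_le _ _).trans (add_le_add ?_ ?_)
      · rw [abs_mul, abs_of_nonneg (by positivity)]
        gcongr
      · rw [abs_mul, abs_of_nonneg hw]
        gcongr
    _ = _ := by ring

lemma integral_bump_sq_muR :
    2.505 ^ 2 ≤ ∫ t, bump t ^ 2 ∂muR ∧ ∫ t, bump t ^ 2 ∂muR < 2.506 ^ 2 := by
  have hT2 := integrableOn_wt_mul_ev 2 [8]
  have hT1 := (integrableOn_wt_mul_ev 1 (padd polyA polyA')).const_mul 4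
  have hT0 := integrableOn_wt_mul_ev 0 polySqSum
  have he1 := (integrableOn_wt_mul_ev 1 [2/1000000, 738/1000000]).const_mul 4
  have he0 := (integrableOn_wt_mul_ev 0 [4/1000000, 782/1000000]).const_mul 3.4
  have hm : Measurable fun t => bump t ^ 2 := measurable_bump.pow_const 2
  obtain ⟨hi, hb⟩ := integral_approx (measurable_wt_mul_orbitSum hm)
    ((hT2.add hT1).add hT0) (he1.add he0) fun q hq => abs_orbitSum_bump_sq_sub_le hq
  have hT21 : IntegrableOn (fun q => wt 2 q * ev [8] q + 4 * (wt 1 q * ev (padd polyA polyA') q))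
    (Set.Ioo 0 1) := hT2.add hT1
  simp only [Pi.add_apply] at hb
  rw [integral_add hT21 hT0, integral_add he1 he0, integral_add hT2 hT1,
    integral_const_mul, integral_const_mul, integral_const_mul, integral_wt_linear,
    integral_wt_linear, integral_wt_const, mom_one_zero, mom_one_one,
    mom_zero_zero, mom_zero_one, mom_two_zero, abs_le] at hb
  have hP := abs_le.1 integral_wt_one_polyAA'_mem
  have hQ := abs_le.1 integral_wt_zero_polySqSum_mem
  obtain ⟨hpi1, hpi2⟩ := pi_sq_bounds
  have hz1 := zetaThree_gt
  have hz2 := zetaThree_lt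
  have hpos : 0 < Real.pi ^ 2 := by positivity
  have h4 : Real.pi ^ 4 = Real.pi ^ 2 * Real.pi ^ 2 := by ring
  -- To leave only linear arithmetic in π², π⁴ is bounded below by the tangent line of y² at y =
  -- 9.8696 and above by 9.8697 π².
  have h41 : 9.8696 * 9.8696 + 2 * 9.8696 * (Real.pi ^ 2 - 9.8696) ≤ Real.pi ^ 4 := by
    rw [h4]; nlinarith [sq_nonneg (Real.pi ^ 2 - 9.8696)]
  have h42 : Real.pi ^ 4 ≤ 9.8697 * Real.pi ^ 2 := by
    rw [h4]; gcongr; linarith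
  rw [integral_muR_orbitSum hm (fun t => sq_nonneg _) hi, div_mul_eq_mul_div, le_div_iff₀ hpos,
    div_lt_iff₀ hpos]
  push_cast at hb
  constructor <;> linarith [hb.1, hb.2, hP.1, hP.2, hQ.1, hQ.2]

/-! ### The two constants and the final comparison -/

lemma c₁_mem : 0.678 ≤ c₁ ∧ c₁ < 0.679 := by
  obtain ⟨hi, h1, h2⟩ := integral_bump_muR
  have h : c₁ = 1 / 2 * ∫ t, bump t ∂muR := by
    change 1 / 2 * lpNorm bump 1 muR = _
    rw [lpNorm_one_eq_integral_norm hi.aestronglyMeasurable]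
    simp only [Real.norm_of_nonneg (bump_nonneg _)]
  rw [h]
  constructor <;> linarith

lemma c₂_mem : 2.505 ≤ c₂ ∧ c₂ < 2.506 := by
  obtain ⟨h1, h2⟩ := integral_bump_sq_muR
  have h : c₂ = Real.sqrt (∫ t, bump t ^ 2 ∂muR) := by
    change lpNorm bump 2 muR = _
    rw [lpNorm_eq_integral_norm_rpow_toReal (by norm_num) (by norm_num)
      measurable_bump.aestronglyMeasurable, Real.sqrt_eq_rpow]
    norm_num
  rw [h]
  exact ⟨Real.le_sqrt_of_sq_le h1, (Real.sqrt_lt' (by norm_num)).2 h2⟩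

/-- The sharper loss 2√ε is weakened to the stated one: c₂ ≥ 2.505 > 2, √ε ≤ ε^{1/8} for ε < 1, and
c₁ε ≥ 0 is given away. -/
lemma sub_le_energy {ε : ℝ} (hε : 0 < ε) (hε1 : ε < 1) (μ : Measure P1) [IsProbabilityMeasure μ]
    (hμ : μ (strip ε)ᶜ = 0) :
    ((7 * (riemannZeta 3).re / (2 * Real.pi ^ 2) - c₁ * ε - c₂ * ε ^ (1 / 8 : ℝ) : ℝ) : EReal)
      ≤ energy μ := by
  refine le_trans (EReal.coe_le_coe_iff.2 ?_) (le_energy μ hμ)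
  have h1 : 0 ≤ c₁ * ε := mul_nonneg (by linarith [c₁_mem.1]) hε.le
  have h2 : Real.sqrt ε ≤ ε ^ (1 / 8 : ℝ) := by
    rw [Real.sqrt_eq_rpow]
    exact Real.rpow_le_rpow_of_exponent_ge hε hε1.le (by norm_num)
  have h3 : 2 * Real.sqrt ε ≤ c₂ * ε ^ (1 / 8 : ℝ) :=
    mul_le_mul (by linarith [c₂_mem.1]) h2 (Real.sqrt_nonneg _) (by linarith [c₂_mem.1])
  linarith

end DeltaRobin

end

theorem mainTheorem3 :
    (0.678 ≤ DeltaRobin.c₁ ∧ DeltaRobin.c₁ < 0.679) ∧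
    (2.505 ≤ DeltaRobin.c₂ ∧ DeltaRobin.c₂ < 2.506) ∧
    ∀ ε : ℝ, 0 < ε → ε < 1 →
      ((7 * (riemannZeta 3).re / (2 * Real.pi ^ 2) - DeltaRobin.c₁ * ε
          - DeltaRobin.c₂ * ε ^ (1 / 8 : ℝ) : ℝ) : EReal)
        ≤ DeltaRobin.robinConstant (DeltaRobin.strip ε) ∧
      ∀ μ : MeasureTheory.Measure DeltaRobin.P1, MeasureTheory.IsProbabilityMeasure μ →
        μ (DeltaRobin.strip ε)ᶜ = 0 →
        ((7 * (riemannZeta 3).re / (2 * Real.pi ^ 2) - DeltaRobin.c₁ * ε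
            - DeltaRobin.c₂ * ε ^ (1 / 8 : ℝ) : ℝ) : EReal)
          ≤ DeltaRobin.energy μ := by
  refine ⟨DeltaRobin.c₁_mem, DeltaRobin.c₂_mem, fun ε hε hε1 => ⟨?_, fun μ hμ hs => ?_⟩⟩
  · exact le_iInf fun μ => le_iInf fun _ => le_iInf fun hs =>
      DeltaRobin.sub_le_energy hε hε1 μ hs
  · exact DeltaRobin.sub_le_energy hε hε1 μ hs
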